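/- Let $n\ge 1$, $\theta>0$, and write $B_r\subset\mathbb{R}^n$ for the open ball of radius $r$ centered at $0$. Consider functions $f\in C^2([0,1))$ with $f\ge 0$ such that $f^{-\theta}$ is concave near $1$ (that is, for some $t_0\in[0,1)$, $f>0$ and $f^{-\theta}$ is concave on $(t_0,1)$). For every such $f$ there is a constant $K\ge 0$ with $$f''(t)f(t)\ \ge\ (1+\theta)\,f'(t)^2-K\qquad\text{for all } 0\le t<1. \tag{1}$$ Moreover, for every $K\ge 0$ there exists a constant $C>0$, depending only on $n$, $\theta$ and $K$, such that the following holds. Let $f$ be as above and satisfy (1) with this $K$, and let $u\in C^2(B_1)$ with $0\le u<1$ be a stable solution of $-\Delta u=f(u)$ in $B_1$, where stable means $$\int_{B_1}\left(|\nabla\xi|^2-f'(u)\,\xi^2\right)dx\ \ge\ 0\qquad\text{for all }\xi\in C_c^\infty(B_1).$$ Then $$\|f(u)\|_{W^{1,2}(B_{1/2})}\ \le\ C\,\|u\|_{L^1(B_{3/4})},$$ where $\|v\|_{W^{1,2}(U)}=\big(\|v\|_{L^2(U)}^2+\|\nabla v\|_{L^2(U)}^2\big)^{1/2}$. -/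

import Mathlib

open Set MeasureTheory
open scoped ENNReal ContDiff Topology

noncomputable section

namespace MEMS

/-- `φ ∈ C^∞_c(U)`: a smooth function on `ℝⁿ` whose support is a compact subset of `U`. -/
def IsTestFunction {n : ℕ} (U : Set (EuclideanSpace ℝ (Fin n)))
    (φ : EuclideanSpace ℝ (Fin n) → ℝ) : Prop :=
  ContDiff ℝ ∞ φ ∧ HasCompactSupport φ ∧ tsupport φ ⊆ U

/-- A nonlinearity of class `C²([0,1))` with `f ≥ 0` there. Values of `f` outside `[0,1)` play no
role; derivatives are taken within `[0,1)`, so they are one-sided at `0`. -/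
def IsNonlinearity (f : ℝ → ℝ) : Prop :=
  ContDiffOn ℝ 2 f (Ico 0 1) ∧ ∀ t ∈ Ico (0 : ℝ) 1, 0 ≤ f t

/-- `f^{-θ}` is concave near `1`: on some interval `(t₀, 1)` the function `f` is positive (so that
`f^{-θ}` is a well-defined real function) and `f^{-θ}` is concave. -/
def ConcaveNearOne (f : ℝ → ℝ) (θ : ℝ) : Prop :=
  ∃ t₀ ∈ Ico (0 : ℝ) 1, (∀ t ∈ Ioo t₀ 1, 0 < f t) ∧
    ConcaveOn ℝ (Ioo t₀ 1) (fun t => f t ^ (-θ))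

/-- `f''(t) f(t) ≥ (1 + θ) f'(t)² - K` for all `0 ≤ t < 1`. -/
def CrandallRabinowitzBound (f : ℝ → ℝ) (θ K : ℝ) : Prop :=
  ∀ t ∈ Ico (0 : ℝ) 1,
    (1 + θ) * derivWithin f (Ico 0 1) t ^ 2 - K ≤ iteratedDerivWithin 2 f (Ico 0 1) t * f t

/-- `u ∈ C²(U)` is a nonnegative classical solution of `-Δu = f(u)` in the open set `U`. As `f`
lives on `[0,1)`, the function `u` takes its values there. -/
def IsNonnegSolution {n : ℕ} (f : ℝ → ℝ) (U : Set (EuclideanSpace ℝ (Fin n)))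
    (u : EuclideanSpace ℝ (Fin n) → ℝ) : Prop :=
  ContDiffOn ℝ 2 u U ∧ (∀ x ∈ U, 0 ≤ u x ∧ u x < 1) ∧
    ∀ x ∈ U, -(Laplacian.laplacian u x) = f (u x)

/-- Stability of `u` in `U`: `∫_U (|∇ξ|² - f'(u) ξ²) ≥ 0` for all `ξ ∈ C^∞_c(U)`. -/
def IsStable {n : ℕ} (f : ℝ → ℝ) (U : Set (EuclideanSpace ℝ (Fin n)))
    (u : EuclideanSpace ℝ (Fin n) → ℝ) : Prop :=
  ∀ ξ : EuclideanSpace ℝ (Fin n) → ℝ, IsTestFunction U ξ →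
    0 ≤ ∫ x in U, (‖gradient ξ x‖ ^ 2 - derivWithin f (Ico 0 1) (u x) * ξ x ^ 2)

/-- `g` is a weak gradient of `v` in the open set `U`. -/
def HasWeakGradient {n : ℕ} (U : Set (EuclideanSpace ℝ (Fin n)))
    (v : EuclideanSpace ℝ (Fin n) → ℝ)
    (g : EuclideanSpace ℝ (Fin n) → EuclideanSpace ℝ (Fin n)) : Prop :=
  LocallyIntegrableOn v U ∧ LocallyIntegrableOn g U ∧
    ∀ φ : EuclideanSpace ℝ (Fin n) → ℝ, IsTestFunction U φ → ∀ i : Fin n,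
      ∫ x in U, v x * gradient φ x i = -∫ x in U, g x i * φ x

/-- The norm `‖v‖_{W^{1,2}(U)} = (‖v‖²_{L²(U)} + ‖∇v‖²_{L²(U)})^{1/2}` with values in `[0,∞]`,
where `∇v` is the weak gradient of `v` in `U` (it is unique almost everywhere, so the infimum is
taken over at most one value). The norm is `∞` exactly when `v` is not in `W^{1,2}(U)`. -/
def sobolevNorm {n : ℕ} (U : Set (EuclideanSpace ℝ (Fin n)))
    (v : EuclideanSpace ℝ (Fin n) → ℝ) : ℝ≥0∞ :=
  ⨅ (g : EuclideanSpace ℝ (Fin n) → EuclideanSpace ℝ (Fin n)) (_ : HasWeakGradient U v g),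
    (eLpNorm v 2 (volume.restrict U) ^ 2 + eLpNorm g 2 (volume.restrict U) ^ 2) ^ (1 / 2 : ℝ)

end MEMS

end

open Set MeasureTheory
open scoped ENNReal NNReal ContDiff Topology

namespace MEMS

variable {n : ℕ}

/-! Concavity of f^{-θ} near 1 is the inequality f''f ≥ (1+θ)f'² there. On the remaining compact
part of [0,1) both sides are continuous, and a constant K absorbs the defect. This gives (1)
(`exists_crandallRabinowitzBound`).

For the estimate, write F = f(u) and let η be a cutoff. Since -ΔF = f'(u)F - f''(u)|∇u|², testing
-ΔF with Fη² and stability with ξ = Fη produces the same term ∫ f'(u)F²η². It cancels and leaves ∫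
f''(u)F|∇u|²η² ≤ ∫ F²|∇η|². With (1), |∇F|² = f'(u)²|∇u|² is controlled up to K|∇u|²
(`integral_sq_mul_norm_gradient_comp_le`). The error K∫|∇u|²η² is handled by testing -Δu = F with
uη². Together the energies of Fη and uη are bounded by weighted L² norms of F and u
(`integral_norm_gradient_add_le`).

These L² norms live on the support of the cutoff, so they must be absorbed. With η = ζ^{n+2}, the
terms on the right carry the weight ζ^{2(n+1)}. A subcritical Sobolev inequality and Hölder bound
them by the L¹ norm to the power 2/(n+2) times the energy of vζ^{n+2} to the power (n+1)/(n+2)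
(`exists_interpolation`). The latter power is below 1, so the energy is at most a constant times the
square of the L¹ norms of F and u (`exists_energy_bound`). Finally ∫F is controlled by ∫u on a
larger ball: test the equation with a cutoff and move the Laplacian onto it
(`exists_setIntegral_le`). -/

/-! ### Functions vanishing off a compact set; gradient and Laplacian in coordinates -/

theorem integrable_of_continuousOn_compact {G : Type*} [NormedAddCommGroup G]
    {S : Set (EuclideanSpace ℝ (Fin n))} (hS : IsCompact S)
    {h : EuclideanSpace ℝ (Fin n) → G} (hc : ContinuousOn h S) (hs : ∀ x ∉ S, h x = 0) :
    Integrable h :=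
  (integrableOn_iff_integrable_of_support_subset
    (fun x hx => by by_contra hxS; exact hx (hs x hxS))).1 (hc.integrableOn_compact hS)

theorem tsupport_subset_of_eq_zero {G : Type*} [NormedAddCommGroup G]
    {S : Set (EuclideanSpace ℝ (Fin n))} (hS : IsClosed S)
    {h : EuclideanSpace ℝ (Fin n) → G} (hs : ∀ x ∉ S, h x = 0) : tsupport h ⊆ S :=
  closure_minimal (fun x hx => by by_contra hxS; exact hx (hs x hxS)) hS

/-- Near a point of S smoothness comes from U; elsewhere the function is locally zero. This makes
products of a cutoff with u or f(u), which are regular only in the ball, globally regular. -/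
theorem contDiff_of_contDiffOn_compact {k : WithTop ℕ∞}
    {S U : Set (EuclideanSpace ℝ (Fin n))} (hS : IsClosed S) (hU : IsOpen U) (hSU : S ⊆ U)
    {h : EuclideanSpace ℝ (Fin n) → ℝ} (hc : ContDiffOn ℝ k h U) (hs : ∀ x ∉ S, h x = 0) :
    ContDiff ℝ k h := by
  refine contDiff_iff_contDiffAt.2 fun x => ?_
  by_cases hx : x ∈ S
  · exact hc.contDiffAt (hU.mem_nhds (hSU hx))
  · refine (contDiffAt_const (c := (0 : ℝ))).congr_of_eventuallyEq ?_
    filter_upwards [hS.isOpen_compl.mem_nhds hx] with y hy using hs y hy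

theorem gradient_eq_zero_of_notMem {S : Set (EuclideanSpace ℝ (Fin n))} (hS : IsClosed S)
    {h : EuclideanSpace ℝ (Fin n) → ℝ} (hs : ∀ x ∉ S, h x = 0) :
    ∀ x ∉ S, gradient h x = 0 := by
  intro x hx
  have : h =ᶠ[𝓝 x] fun _ => (0 : ℝ) := by
    filter_upwards [hS.isOpen_compl.mem_nhds hx] with y hy using hs y hy
  rw [this.gradient_eq, gradient_fun_const]

theorem gradient_apply (h : EuclideanSpace ℝ (Fin n) → ℝ) (x : EuclideanSpace ℝ (Fin n))
    (i : Fin n) : gradient h x i = fderiv ℝ h x (EuclideanSpace.basisFun (Fin n) ℝ i) := by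
  rw [← inner_gradient_left, EuclideanSpace.basisFun_apply, EuclideanSpace.inner_single_right]
  simp

theorem norm_fderiv_eq_norm_gradient (h : EuclideanSpace ℝ (Fin n) → ℝ)
    (x : EuclideanSpace ℝ (Fin n)) : ‖fderiv ℝ h x‖ = ‖gradient h x‖ := by
  rw [← toDual_gradient, LinearIsometryEquiv.norm_map]

theorem continuousOn_gradient {U : Set (EuclideanSpace ℝ (Fin n))} (hU : IsOpen U)
    {h : EuclideanSpace ℝ (Fin n) → ℝ} (hh : ContDiffOn ℝ 1 h U) :
    ContinuousOn (gradient h) U :=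
  (InnerProductSpace.toDual ℝ (EuclideanSpace ℝ (Fin n))).symm.continuous.comp_continuousOn
    (hh.continuousOn_fderiv_of_isOpen hU le_rfl)

theorem gradient_mul {v w : EuclideanSpace ℝ (Fin n) → ℝ} {x : EuclideanSpace ℝ (Fin n)}
    (hv : DifferentiableAt ℝ v x) (hw : DifferentiableAt ℝ w x) :
    gradient (fun y => v y * w y) x = v x • gradient w x + w x • gradient v x := by
  simp only [gradient]
  rw [fderiv_fun_mul hv hw]
  simp

theorem laplacian_eq_sum {v : EuclideanSpace ℝ (Fin n) → ℝ} {x : EuclideanSpace ℝ (Fin n)}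
    (hv : ContDiffAt ℝ 2 v x) :
    Laplacian.laplacian v x = ∑ i, fderiv ℝ
      (fun y => fderiv ℝ v y (EuclideanSpace.basisFun (Fin n) ℝ i)) x
        (EuclideanSpace.basisFun (Fin n) ℝ i) := by
  rw [InnerProductSpace.laplacian_eq_iteratedFDeriv_orthonormalBasis v
    (EuclideanSpace.basisFun (Fin n) ℝ)]
  refine Finset.sum_congr rfl fun i _ => ?_
  have hd : DifferentiableAt ℝ (fderiv ℝ v) x :=
    (hv.fderiv_right (m := 1) (by norm_num)).differentiableAt (by norm_num)
  rw [iteratedFDeriv_two_apply, fderiv_clm_apply hd (differentiableAt_const _)]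
  simp

theorem continuousOn_laplacian {U : Set (EuclideanSpace ℝ (Fin n))} (hU : IsOpen U)
    {v : EuclideanSpace ℝ (Fin n) → ℝ} (hv : ContDiffOn ℝ 2 v U) :
    ContinuousOn (Laplacian.laplacian v) U := by
  have h1 : ∀ i, ContDiffOn ℝ 1
      (fun y => fderiv ℝ v y (EuclideanSpace.basisFun (Fin n) ℝ i)) U := fun i =>
    (hv.fderiv_of_isOpen hU (by norm_num)).clm_apply contDiffOn_const
  have h2 : ContinuousOn (fun x => ∑ i, fderiv ℝ
      (fun y => fderiv ℝ v y (EuclideanSpace.basisFun (Fin n) ℝ i)) x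
        (EuclideanSpace.basisFun (Fin n) ℝ i)) U :=
    continuousOn_finsetSum _ fun i _ =>
      ((h1 i).continuousOn_fderiv_of_isOpen hU le_rfl).clm_apply continuousOn_const
  exact h2.congr fun x hx => laplacian_eq_sum (hv.contDiffAt (hU.mem_nhds hx))

/-! ### Integration by parts and Green's identity -/

/-- Integration by parts when one factor is only smooth near the support of the other. -/
theorem integral_mul_fderiv_eq_neg {S U : Set (EuclideanSpace ℝ (Fin n))} (hS : IsCompact S)
    (hU : IsOpen U) (hSU : S ⊆ U) {v φ : EuclideanSpace ℝ (Fin n) → ℝ}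
    (hv : ContDiffOn ℝ 1 v U) (hφ : ContDiff ℝ 1 φ) (hs : ∀ x ∉ S, φ x = 0)
    (e : EuclideanSpace ℝ (Fin n)) :
    ∫ x, φ x * fderiv ℝ v x e = -∫ x, fderiv ℝ φ x e * v x := by
  have hts := tsupport_subset_of_eq_zero hS.isClosed hs
  have hvc := (hv.continuousOn).mono hSU
  have hdv : ContinuousOn (fun x => fderiv ℝ v x e) S :=
    ((hv.continuousOn_fderiv_of_isOpen hU le_rfl).mono hSU).clm_apply continuousOn_const
  have hφc := hφ.continuous
  have hdφ : Continuous (fun x => fderiv ℝ φ x e) :=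
    (hφ.continuous_fderiv one_ne_zero).clm_apply continuous_const
  have h0 : ∀ x ∉ S, fderiv ℝ φ x e = 0 := fun x hx => by
    rw [← inner_gradient_left, gradient_eq_zero_of_notMem hS.isClosed hs x hx, inner_zero_left]
  refine integral_mul_fderiv_eq_neg_fderiv_mul_of_integrable ?_ ?_ ?_ ?_ ?_
  · exact integrable_of_continuousOn_compact hS (hdφ.continuousOn.mul hvc)
      fun x hx => by rw [h0 x hx, zero_mul]
  · exact integrable_of_continuousOn_compact hS (hφc.continuousOn.mul hdv)
      fun x hx => by rw [hs x hx, zero_mul]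
  · exact integrable_of_continuousOn_compact hS (hφc.continuousOn.mul hvc)
      fun x hx => by rw [hs x hx, zero_mul]
  · exact fun x _ => hφ.differentiable one_ne_zero x
  · exact fun x hx => (hv.contDiffAt (hU.mem_nhds (hSU (hts hx)))).differentiableAt one_ne_zero

/-- Coordinatewise integration by parts. One derivative of φ suffices because both derivatives in
the Laplacian start on v; this permits φ = vη² below. -/
theorem green_identity {S U : Set (EuclideanSpace ℝ (Fin n))} (hS : IsCompact S)
    (hU : IsOpen U) (hSU : S ⊆ U) {v φ : EuclideanSpace ℝ (Fin n) → ℝ}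
    (hv : ContDiffOn ℝ 2 v U) (hφ : ContDiff ℝ 1 φ) (hs : ∀ x ∉ S, φ x = 0) :
    ∫ x, φ x * Laplacian.laplacian v x = -∫ x, inner ℝ (gradient φ x) (gradient v x) := by
  set e := EuclideanSpace.basisFun (Fin n) ℝ
  have h1 : ∀ i, ContDiffOn ℝ 1 (fun y => fderiv ℝ v y (e i)) U := fun i =>
    (hv.fderiv_of_isOpen hU (by norm_num)).clm_apply contDiffOn_const
  have hL : ∀ x, φ x * Laplacian.laplacian v x =
      ∑ i, φ x * fderiv ℝ (fun y => fderiv ℝ v y (e i)) x (e i) := fun x => by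
    by_cases hx : x ∈ S
    · rw [laplacian_eq_sum (hv.contDiffAt (hU.mem_nhds (hSU hx))), Finset.mul_sum]
    · simp [hs x hx]
  have hR : ∀ x, inner ℝ (gradient φ x) (gradient v x) =
      ∑ i, fderiv ℝ φ x (e i) * fderiv ℝ v x (e i) := fun x => by
    rw [PiLp.inner_apply]
    refine Finset.sum_congr rfl fun i _ => ?_
    rw [gradient_apply, gradient_apply]
    simp [e, mul_comm]
  simp_rw [hL, hR]
  have h0 : ∀ i, ∀ x ∉ S, fderiv ℝ φ x (e i) = 0 := fun i x hx => by
    rw [← inner_gradient_left, gradient_eq_zero_of_notMem hS.isClosed hs x hx, inner_zero_left]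
  rw [integral_finsetSum, integral_finsetSum, ← Finset.sum_neg_distrib]
  · exact Finset.sum_congr rfl fun i _ => integral_mul_fderiv_eq_neg hS hU hSU (h1 i) hφ hs _
  · intro i _
    refine integrable_of_continuousOn_compact hS ?_ fun x hx => by rw [h0 i x hx, zero_mul]
    exact (((hφ.continuous_fderiv one_ne_zero).clm_apply continuous_const).continuousOn).mul
      ((h1 i).continuousOn.mono hSU)
  · intro i _
    refine integrable_of_continuousOn_compact hS ?_ fun x hx => by rw [hs x hx, zero_mul]
    exact hφ.continuous.continuousOn.mul
      ((((h1 i).continuousOn_fderiv_of_isOpen hU le_rfl).mono hSU).clm_apply continuousOn_const)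

/-- The identity obtained by testing `-Δv` against `v η²`. -/
theorem integral_norm_gradient_mul_sq {S U : Set (EuclideanSpace ℝ (Fin n))} (hS : IsCompact S)
    (hU : IsOpen U) (hSU : S ⊆ U) {v η : EuclideanSpace ℝ (Fin n) → ℝ}
    (hv : ContDiffOn ℝ 2 v U) (hη : ContDiff ℝ 2 η) (hs : ∀ x ∉ S, η x = 0) :
    ∫ x, ‖gradient (fun y => v y * η y) x‖ ^ 2 =
      (∫ x, -Laplacian.laplacian v x * v x * η x ^ 2) + ∫ x, v x ^ 2 * ‖gradient η x‖ ^ 2 := by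
  have hv1 : ContDiffOn ℝ 1 v U := hv.of_le (by norm_num)
  have hη1 : ContDiff ℝ 1 η := hη.of_le (by norm_num)
  have hφ : ContDiff ℝ 1 (fun x => v x * η x ^ 2) :=
    contDiff_of_contDiffOn_compact hS.isClosed hU hSU (hv1.mul (hη1.pow 2).contDiffOn)
      fun x hx => by simp [hs x hx]
  have hg := green_identity hS hU hSU hv hφ fun x hx => by simp [hs x hx]
  have hη0 := gradient_eq_zero_of_notMem hS.isClosed hs
  have hvd : ∀ x ∈ S, DifferentiableAt ℝ v x := fun x hx =>
    (hv1.contDiffAt (hU.mem_nhds (hSU hx))).differentiableAt one_ne_zero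
  have hηd : ∀ x, DifferentiableAt ℝ η x := hη1.differentiable one_ne_zero
  -- Expanding both sides gives |∇(vη)|² = ∇(vη²)·∇v + v²|∇η|²; Green's identity with φ = vη² then
  -- handles the first term.
  have hpt : ∀ x, ‖gradient (fun y => v y * η y) x‖ ^ 2 =
      inner ℝ (gradient (fun x => v x * η x ^ 2) x) (gradient v x) +
        v x ^ 2 * ‖gradient η x‖ ^ 2 := fun x => by
    by_cases hx : x ∈ S
    · have h2 : gradient (fun y => η y ^ 2) x = (2 * η x) • gradient η x := by
        simp_rw [pow_two]
        rw [gradient_mul (hηd x) (hηd x), ← add_smul, two_mul]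
      rw [gradient_mul (hvd x hx) (hηd x), gradient_mul (w := fun y => η y ^ 2) (hvd x hx) ((hηd x).pow 2), h2,
        norm_add_sq_real, norm_smul, norm_smul, mul_pow, mul_pow, inner_add_left,
        inner_smul_left, inner_smul_left, inner_smul_left, inner_smul_left, inner_smul_right,
        real_inner_self_eq_norm_sq]
      simp
      ring
    · rw [hη0 x hx, gradient_eq_zero_of_notMem hS.isClosed (fun x hx => by simp [hs x hx]) x hx,
        gradient_eq_zero_of_notMem hS.isClosed (fun x hx => by simp [hs x hx]) x hx]
      simp
  have hgv := (continuousOn_gradient hU hv1).mono hSU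
  have hgη := (continuousOn_gradient isOpen_univ hη1.contDiffOn).mono (subset_univ S)
  have hgφ := (continuousOn_gradient isOpen_univ hφ.contDiffOn).mono (subset_univ S)
  simp_rw [hpt]
  rw [integral_add]
  · congr 1
    rw [← neg_eq_iff_eq_neg.2 hg, ← integral_neg]
    congr 1 with x
    ring
  · refine integrable_of_continuousOn_compact hS (hgφ.inner hgv) fun x hx => ?_
    rw [gradient_eq_zero_of_notMem hS.isClosed (fun x hx => by simp [hs x hx]) x hx,
      inner_zero_left]
  · exact integrable_of_continuousOn_compact hS
      (((hv1.continuousOn.mono hSU).pow 2).mul (hgη.norm.pow 2)) fun x hx => by simp [hη0 x hx]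

/-! ### Chain rule for f(u) with one-sided derivatives of f -/

/-- Although f is differentiable only within I, u sends a neighbourhood of x into I, so the
composition has a full derivative. This covers the points where u = 0. -/
theorem hasFDerivAt_comp_of_mapsTo {I : Set ℝ}
    {U : Set (EuclideanSpace ℝ (Fin n))} (hU : IsOpen U) {f : ℝ → ℝ}
    {u : EuclideanSpace ℝ (Fin n) → ℝ} (hm : MapsTo u U I) {x : EuclideanSpace ℝ (Fin n)}
    (hx : x ∈ U) (hf : DifferentiableWithinAt ℝ f I (u x)) (hu : DifferentiableAt ℝ u x) :
    HasFDerivAt (fun y => f (u y)) (derivWithin f I (u x) • fderiv ℝ u x) x :=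
  (hf.hasDerivWithinAt.comp_hasFDerivWithinAt x hu.hasFDerivAt.hasFDerivWithinAt hm).hasFDerivAt
    (hU.mem_nhds hx)

theorem gradient_comp_of_mapsTo {I : Set ℝ}
    {U : Set (EuclideanSpace ℝ (Fin n))} (hU : IsOpen U) {f : ℝ → ℝ}
    {u : EuclideanSpace ℝ (Fin n) → ℝ} (hm : MapsTo u U I) {x : EuclideanSpace ℝ (Fin n)}
    (hx : x ∈ U) (hf : DifferentiableWithinAt ℝ f I (u x)) (hu : DifferentiableAt ℝ u x) :
    gradient (fun y => f (u y)) x = derivWithin f I (u x) • gradient u x := by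
  simp only [gradient]
  rw [(hasFDerivAt_comp_of_mapsTo hU hm hx hf hu).fderiv]
  simp

theorem iteratedDerivWithin_two (f : ℝ → ℝ) (s : Set ℝ) (t : ℝ) :
    iteratedDerivWithin 2 f s t = derivWithin (derivWithin f s) s t := by
  rw [iteratedDerivWithin_succ, iteratedDerivWithin_one]

theorem laplacian_comp_of_mapsTo {I : Set ℝ} (hI : UniqueDiffOn ℝ I)
    {U : Set (EuclideanSpace ℝ (Fin n))} (hU : IsOpen U) {f : ℝ → ℝ}
    {u : EuclideanSpace ℝ (Fin n) → ℝ} (hm : MapsTo u U I) {x : EuclideanSpace ℝ (Fin n)}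
    (hx : x ∈ U) (hf : ContDiffOn ℝ 2 f I) (hu : ContDiffOn ℝ 2 u U) :
    Laplacian.laplacian (fun y => f (u y)) x =
      derivWithin f I (u x) * Laplacian.laplacian u x +
        iteratedDerivWithin 2 f I (u x) * ‖gradient u x‖ ^ 2 := by
  have hux := hu.contDiffAt (hU.mem_nhds hx)
  have hfu : ContDiffAt ℝ 2 (fun y => f (u y)) x :=
    (hf.comp hu hm).contDiffAt (hU.mem_nhds hx)
  have hf' : DifferentiableOn ℝ (derivWithin f I) I :=
    (hf.derivWithin hI (m := 1) (by norm_num)).differentiableOn (by norm_num)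
  rw [laplacian_eq_sum hux, laplacian_eq_sum hfu, ← real_inner_self_eq_norm_sq, PiLp.inner_apply,
    Finset.mul_sum, Finset.mul_sum, ← Finset.sum_add_distrib]
  refine Finset.sum_congr rfl fun i _ => ?_
  set e := EuclideanSpace.basisFun (Fin n) ℝ i
  have hev : (fun y => fderiv ℝ (fun y => f (u y)) y e) =ᶠ[𝓝 x]
      fun y => derivWithin f I (u y) * fderiv ℝ u y e := by
    filter_upwards [hU.mem_nhds hx] with y hy
    rw [(hasFDerivAt_comp_of_mapsTo hU hm hy (hf.differentiableOn (by norm_num) _ (hm hy))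
      ((hu.contDiffAt (hU.mem_nhds hy)).differentiableAt (by norm_num))).fderiv]
    simp
  have h1 := hasFDerivAt_comp_of_mapsTo hU hm hx (hf' _ (hm hx))
    (hux.differentiableAt (by norm_num))
  have h2 : DifferentiableAt ℝ (fun y => fderiv ℝ u y e) x :=
    ((hux.fderiv_right (m := 1) (by norm_num)).differentiableAt (by norm_num)).clm_apply
      (differentiableAt_const _)
  rw [hev.fderiv_eq, fderiv_fun_mul h1.differentiableAt h2, h1.fderiv, gradient_apply,
    iteratedDerivWithin_two]
  simp [e]
  ring

/-! ### Mollification and stability for C¹ test functions -/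

open Convolution in
/-- Approximation of compactly supported `C¹` functions by test functions in the `C¹` norm. -/
theorem exists_smooth_approx {S : Set (EuclideanSpace ℝ (Fin n))} (hS : IsCompact S)
    {ξ : EuclideanSpace ℝ (Fin n) → ℝ} (hξ : ContDiff ℝ 1 ξ) (hs : ∀ x ∉ S, ξ x = 0)
    {δ r : ℝ} (hδ : 0 < δ) (hr : 0 < r) :
    ∃ g : EuclideanSpace ℝ (Fin n) → ℝ, ContDiff ℝ ∞ g ∧ (∀ x, |g x - ξ x| ≤ δ) ∧
      (∀ x, ‖gradient g x - gradient ξ x‖ ≤ δ) ∧ ∀ x ∉ Metric.cthickening r S, g x = 0 := by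
  have hcs : HasCompactSupport ξ := HasCompactSupport.intro hS hs
  have hcd := hξ.continuous_fderiv one_ne_zero
  obtain ⟨r₁, hr₁, h₁⟩ := Metric.uniformContinuous_iff.1
    (hcs.uniformContinuous_of_continuous hξ.continuous) δ hδ
  obtain ⟨r₂, hr₂, h₂⟩ := Metric.uniformContinuous_iff.1
    ((hcs.fderiv ℝ).uniformContinuous_of_continuous hcd) δ hδ
  -- At scale ρ both ξ and its derivative oscillate by at most δ, and convolution enlarges the
  -- support by at most r.
  set ρ := min r (min r₁ r₂)
  have hρ : 0 < ρ := lt_min hr (lt_min hr₁ hr₂)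
  let φ : ContDiffBump (0 : EuclideanSpace ℝ (Fin n)) :=
    ⟨ρ / 2, ρ, half_pos hρ, half_lt_self hρ⟩
  set L := ContinuousLinearMap.lsmul ℝ ℝ (E := ℝ)
  have hφl : LocallyIntegrable (φ.normed volume) volume := φ.continuous_normed.locallyIntegrable
  refine ⟨φ.normed volume ⋆[L, volume] ξ, ?_, ?_, ?_, ?_⟩
  · exact φ.hasCompactSupport_normed.contDiff_convolution_left _ φ.contDiff_normed
      hξ.continuous.locallyIntegrable
  · intro x
    rw [← Real.dist_eq]
    refine φ.dist_normed_convolution_le hξ.continuous.aestronglyMeasurable fun y hy => ?_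
    exact (h₁ (lt_of_lt_of_le hy ((min_le_right _ _).trans (min_le_left _ _)))).le
  · intro x
    have hd := hcs.hasFDerivAt_convolution_right L hφl hξ x
    have heq : (φ.normed volume ⋆[L.precompR (EuclideanSpace ℝ (Fin n)), volume] fderiv ℝ ξ) x =
        (φ.normed volume ⋆[ContinuousLinearMap.lsmul ℝ ℝ, volume] fderiv ℝ ξ) x := by
      simp only [convolution]
      rfl
    have hle : dist ((φ.normed volume ⋆[ContinuousLinearMap.lsmul ℝ ℝ, volume] fderiv ℝ ξ) x)
        (fderiv ℝ ξ x) ≤ δ := by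
      refine φ.dist_normed_convolution_le hcd.aestronglyMeasurable fun y hy => ?_
      exact (h₂ (lt_of_lt_of_le hy ((min_le_right _ _).trans (min_le_right _ _)))).le
    rw [heq] at hd
    rw [← hd.fderiv, dist_eq_norm] at hle
    simpa only [gradient, ← map_sub, LinearIsometryEquiv.norm_map] using hle
  · intro x hx
    have hz : ∀ y ∈ Metric.ball x ρ, ξ y = 0 := fun y hy => by
      refine hs y fun hyS => hx ?_
      refine Metric.mem_cthickening_of_dist_le x y r S hyS ?_
      rw [dist_comm]
      exact (lt_of_lt_of_le hy (min_le_left _ _)).le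
    have hx0 := hz x (Metric.mem_ball_self hρ)
    -- Off the thickening ξ vanishes on the whole averaging ball, so the oscillation bound holds
    -- with ε = 0 and forces the convolution to be 0.
    have := φ.dist_normed_convolution_le (ε := 0) (x₀ := x) (g := ξ) (μ := volume)
      hξ.continuous.aestronglyMeasurable fun y hy => by rw [hz y hy, hx0, dist_self]
    rw [hx0] at this
    exact dist_le_zero.1 this

/-- Stability may be tested with compactly supported `C¹` functions. -/
theorem IsStable.integral_nonneg {f : ℝ → ℝ} {U S : Set (EuclideanSpace ℝ (Fin n))}
    {u : EuclideanSpace ℝ (Fin n) → ℝ} (hst : IsStable f U u) (hU : IsOpen U) (hS : IsCompact S)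
    (hSU : S ⊆ U) (hc : ContinuousOn (fun x => derivWithin f (Ico 0 1) (u x)) U)
    {ξ : EuclideanSpace ℝ (Fin n) → ℝ} (hξ : ContDiff ℝ 1 ξ) (hs : ∀ x ∉ S, ξ x = 0) :
    0 ≤ ∫ x, (‖gradient ξ x‖ ^ 2 - derivWithin f (Ico 0 1) (u x) * ξ x ^ 2) := by
  -- A fixed thickening T inside U contains the supports of all approximations, so one compact set
  -- serves for every bound.
  obtain ⟨r, hr, hrU⟩ := hS.exists_cthickening_subset_open hU hSU
  set T := Metric.cthickening r S
  have hT : IsCompact T := hS.cthickening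
  obtain ⟨M, hM⟩ := hT.exists_bound_of_continuousOn (hc.mono hrU)
  obtain ⟨A, hA⟩ := hT.exists_bound_of_continuousOn (hξ.continuous.continuousOn (s := T))
  obtain ⟨B, hB⟩ := hT.exists_bound_of_continuousOn
    ((continuousOn_gradient isOpen_univ hξ.contDiffOn).mono (subset_univ T))
  have hex : ∀ k : ℕ, ∃ g : EuclideanSpace ℝ (Fin n) → ℝ, ContDiff ℝ ∞ g ∧
      (∀ x, |g x - ξ x| ≤ 1 / ((k : ℝ) + 1)) ∧
      (∀ x, ‖gradient g x - gradient ξ x‖ ≤ 1 / ((k : ℝ) + 1)) ∧ ∀ x ∉ T, g x = 0 := fun k =>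
    exists_smooth_approx hS hξ hs (by positivity) hr
  choose g hg hg0 hg1 hgT using hex
  have hlim0 : ∀ x, Filter.Tendsto (fun k => g k x) Filter.atTop (𝓝 (ξ x)) := fun x =>
    tendsto_iff_norm_sub_tendsto_zero.2 (squeeze_zero (fun _ => norm_nonneg _)
      (fun k => hg0 k x) tendsto_one_div_add_atTop_nhds_zero_nat)
  have hlim1 : ∀ x, Filter.Tendsto (fun k => gradient (g k) x) Filter.atTop
      (𝓝 (gradient ξ x)) := fun x =>
    tendsto_iff_norm_sub_tendsto_zero.2 (squeeze_zero (fun _ => norm_nonneg _)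
      (fun k => hg1 k x) tendsto_one_div_add_atTop_nhds_zero_nat)
  have hgz : ∀ k, ∀ x ∉ T, gradient (g k) x = 0 := fun k =>
    gradient_eq_zero_of_notMem hT.isClosed (hgT k)
  have hint : ∀ k, Integrable
      (fun x => ‖gradient (g k) x‖ ^ 2 - derivWithin f (Ico 0 1) (u x) * g k x ^ 2) := fun k => by
    refine integrable_of_continuousOn_compact hT ?_ fun x hx => by simp [hgz k x hx, hgT k x hx]
    have h1 := (continuousOn_gradient isOpen_univ
      ((hg k).of_le (by simp)).contDiffOn).mono (subset_univ T)
    exact (h1.norm.pow 2).sub ((hc.mono hrU).mul ((hg k).continuous.continuousOn.pow 2))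
  have hnn : ∀ k, 0 ≤ ∫ x,
      (‖gradient (g k) x‖ ^ 2 - derivWithin f (Ico 0 1) (u x) * g k x ^ 2) := fun k => by
    refine (hst (g k) ⟨hg k, HasCompactSupport.intro hT (hgT k),
      (tsupport_subset_of_eq_zero hT.isClosed (hgT k)).trans hrU⟩).trans_eq ?_
    refine setIntegral_eq_integral_of_forall_compl_eq_zero fun x hx => ?_
    have hxT : x ∉ T := fun h => hx (hrU h)
    simp [hgz k x hxT, hgT k x hxT]
  -- The approximations lie within 1 of ξ in C¹, so A + 1 and B + 1 bound them and their gradients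
  -- on T, while M bounds f'(u) there.
  refine ge_of_tendsto' (tendsto_integral_of_dominated_convergence
    (T.indicator fun _ => (B + 1) ^ 2 + M * (A + 1) ^ 2) (fun k => (hint k).aestronglyMeasurable)
    ?_ (fun k => Filter.Eventually.of_forall fun x => ?_)
    (Filter.Eventually.of_forall fun x =>
      (((hlim1 x).norm.pow 2).sub (((hlim0 x).pow 2).const_mul _)))) hnn
  · exact (integrable_indicator_iff hT.measurableSet).2
      (integrableOn_const hT.measure_lt_top.ne)
  · by_cases hx : x ∈ T
    · rw [indicator_of_mem hx]
      have hk : 1 / ((k : ℝ) + 1) ≤ 1 := by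
        rw [div_le_one (by positivity)]
        simp
      have a1 : ‖gradient (g k) x‖ ≤ B + 1 := by
        have := norm_le_norm_add_norm_sub' (gradient (g k) x) (gradient ξ x)
        linarith [hg1 k x, hB x hx]
      have a2 : |g k x| ≤ A + 1 := by
        have := norm_le_norm_add_norm_sub' (g k x) (ξ x)
        simp only [Real.norm_eq_abs] at this
        linarith [hg0 k x, (Real.norm_eq_abs _) ▸ hA x hx]
      have a3 := hM x hx
      refine (norm_sub_le _ _).trans (add_le_add ?_ ?_)
      · rw [norm_pow, norm_norm]
        gcongr
      · rw [norm_mul, norm_pow, Real.norm_eq_abs (g k x)]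
        gcongr
        exact (norm_nonneg _).trans a3
    · rw [indicator_of_notMem hx]
      simp [hgz k x hx, hgT k x hx]

/-! ### Sobolev inequality and weighted interpolation -/

theorem enorm_gradient_eq (g : EuclideanSpace ℝ (Fin n) → ℝ) (x : EuclideanSpace ℝ (Fin n)) :
    ‖fderiv ℝ g x‖ₑ = ‖gradient g x‖ₑ := by
  rw [← ofReal_norm, ← ofReal_norm, norm_fderiv_eq_norm_gradient]

/-- In dimension one, a compactly supported `C¹` function is bounded by the total variation. -/
theorem enorm_le_lintegral_gradient_of_one {g : EuclideanSpace ℝ (Fin 1) → ℝ}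
    (hg : ContDiff ℝ 1 g) (hc : HasCompactSupport g) (x : EuclideanSpace ℝ (Fin 1)) :
    ‖g x‖ₑ ≤ ∫⁻ y, ‖gradient g y‖ₑ := by
  set ψ : ℝ ≃ₗᵢ[ℝ] EuclideanSpace ℝ (Fin 1) := (OrthonormalBasis.singleton (Fin 1) ℝ).repr
  have h1 : ContDiff ℝ 1 (g ∘ ψ) := hg.comp ψ.contDiff
  have h2 : HasCompactSupport (g ∘ ψ) := hc.comp_homeomorph ψ.toHomeomorph
  have h3 := h2.enorm_le_lintegral_Ici_deriv h1 (ψ.symm x)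
  simp only [Function.comp_apply, LinearIsometryEquiv.apply_symm_apply] at h3
  refine h3.trans ((setLIntegral_le_lintegral _ _).trans ?_)
  rw [← ψ.measurePreserving.lintegral_comp_emb ψ.toHomeomorph.measurableEmbedding]
  refine lintegral_mono fun t => ?_
  have hd : HasDerivAt (g ∘ ψ) (fderiv ℝ g (ψ t) (ψ 1)) t := by
    have := (hg.differentiable one_ne_zero (ψ t)).hasFDerivAt.comp t
      (ψ.toContinuousLinearEquiv : ℝ →L[ℝ] EuclideanSpace ℝ (Fin 1)).hasFDerivAt
    simpa using this.hasDerivAt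
  rw [show deriv (g ∘ ψ) t = fderiv ℝ g (ψ t) (ψ 1) from hd.deriv, ← enorm_gradient_eq,
    ← ofReal_norm, ← ofReal_norm]
  refine ENNReal.ofReal_le_ofReal (((fderiv ℝ g (ψ t)).le_opNorm _).trans_eq ?_)
  simp

/-- Hölder on the ball carrying the support: lowers the exponent 2 to the p required by the Sobolev
inequality. -/
theorem eLpNorm_gradient_le {g : EuclideanSpace ℝ (Fin n) → ℝ} (hg : ContDiff ℝ 1 g)
    {R : ℝ} (hs : ∀ x ∉ Metric.closedBall 0 R, g x = 0) {p : ℝ≥0∞} (hp : p ≤ 2) :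
    eLpNorm (gradient g) p volume ≤ eLpNorm (gradient g) 2 volume *
      volume (Metric.closedBall (0 : EuclideanSpace ℝ (Fin n)) R)
        ^ (1 / p.toReal - 1 / (2 : ℝ≥0∞).toReal) := by
  have h0 := gradient_eq_zero_of_notMem Metric.isClosed_closedBall hs
  have hsupp : Function.support (gradient g) ⊆ Metric.closedBall 0 R :=
    fun x hx => by by_contra h; exact hx (h0 x h)
  have hm : Continuous (gradient g) :=
    (continuousOn_univ.1 (continuousOn_gradient isOpen_univ hg.contDiffOn))
  rw [← eLpNorm_restrict_eq_of_support_subset hsupp,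
    ← eLpNorm_restrict_eq_of_support_subset (p := 2) hsupp]
  have := eLpNorm_le_eLpNorm_mul_rpow_measure_univ hp
    (hm.aestronglyMeasurable (μ := volume.restrict (Metric.closedBall 0 R)))
  rwa [Measure.restrict_apply_univ] at this

/-- A subcritical Sobolev inequality, valid in every dimension. -/
theorem exists_eLpNorm_le_eLpNorm_gradient (hn : 1 ≤ n) (R : ℝ) :
    ∃ C : ℝ≥0, ∀ g : EuclideanSpace ℝ (Fin n) → ℝ, ContDiff ℝ 1 g →
      (∀ x ∉ Metric.closedBall 0 R, g x = 0) →
      eLpNorm g (ENNReal.ofReal (2 + 2 / n)) volume ≤ C * eLpNorm (gradient g) 2 volume := by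
  set V := volume (Metric.closedBall (0 : EuclideanSpace ℝ (Fin n)) R)
  have hV : V ≠ ⊤ := measure_closedBall_lt_top.ne
  rcases hn.eq_or_lt with rfl | hn2
  -- In dimension one the sup norm is bounded by the L¹ norm of the gradient, so the finite volume
  -- of the ball does the rest.
  · set q := ENNReal.ofReal (2 + 2 / ((1 : ℕ) : ℝ))
    refine ⟨(V ^ (1 / (1 : ℝ≥0∞).toReal - 1 / (2 : ℝ≥0∞).toReal) * V ^ q.toReal⁻¹).toNNReal,
      fun g hg hs => ?_⟩
    have hsupp : Function.support g ⊆ Metric.closedBall 0 R :=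
      fun x hx => by by_contra h; exact hx (hs x h)
    have hc : HasCompactSupport g := HasCompactSupport.intro (isCompact_closedBall 0 R) hs
    have h1 : eLpNorm g q volume ≤ eLpNorm (gradient g) 1 volume * V ^ q.toReal⁻¹ := by
      rw [← eLpNorm_restrict_eq_of_support_subset hsupp, eLpNorm_one_eq_lintegral_enorm]
      refine (eLpNorm_le_of_ae_enorm_bound (Filter.Eventually.of_forall
        (enorm_le_lintegral_gradient_of_one hg hc))).trans_eq ?_
      rw [Measure.restrict_apply_univ, smul_eq_mul]
    have h2 := eLpNorm_gradient_le hg hs (p := 1) (by norm_num)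
    rw [ENNReal.coe_toNNReal, mul_comm, ← mul_assoc]
    · exact h1.trans (by gcongr)
    · refine ENNReal.mul_ne_top (ENNReal.rpow_ne_top_of_nonneg (by norm_num) hV)
        (ENNReal.rpow_ne_top_of_nonneg (by positivity) hV)
  · have hnR : (2 : ℝ) ≤ n := by exact_mod_cast hn2
    -- This p solves 1/p - 1/n = 1/q, so q = 2 + 2/n is exactly its Sobolev exponent; moreover 1 ≤ p
    -- ≤ 2 and p < n.
    set p : ℝ≥0 := ⟨2 * n * (n + 1) / (n ^ 2 + 2 * n + 2), by positivity⟩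
    set q : ℝ≥0 := ⟨2 + 2 / n, by positivity⟩
    have hpv : (p : ℝ) = 2 * n * (n + 1) / (n ^ 2 + 2 * n + 2) := rfl
    have hqv : (q : ℝ) = 2 + 2 / n := rfl
    have hp1 : 1 ≤ p := by
      rw [← NNReal.coe_le_coe, hpv, NNReal.coe_one, le_div_iff₀ (by positivity)]
      nlinarith
    have hp2 : p ≤ 2 := by
      rw [← NNReal.coe_le_coe, hpv, NNReal.coe_ofNat, div_le_iff₀ (by positivity)]
      nlinarith
    have hpn : p < Module.finrank ℝ (EuclideanSpace ℝ (Fin n)) := by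
      rw [← NNReal.coe_lt_coe, hpv, finrank_euclideanSpace_fin, NNReal.coe_natCast,
        div_lt_iff₀ (by positivity)]
      nlinarith
    have hpq : (p : ℝ)⁻¹ - (Module.finrank ℝ (EuclideanSpace ℝ (Fin n)) : ℝ)⁻¹ ≤ (q : ℝ)⁻¹ := by
      rw [hpv, hqv, finrank_euclideanSpace_fin]
      apply le_of_eq
      field_simp
      ring
    refine ⟨eLpNormLESNormFDerivOfLeConst ℝ (volume : Measure (EuclideanSpace ℝ (Fin n)))
      (Metric.closedBall 0 R) p q *
        (V ^ (1 / (p : ℝ≥0∞).toReal - 1 / (2 : ℝ≥0∞).toReal)).toNNReal, fun g hg hs => ?_⟩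
    have hsupp : Function.support g ⊆ Metric.closedBall 0 R :=
      fun x hx => by by_contra h; exact hx (hs x h)
    have h1 := eLpNorm_le_eLpNorm_fderiv_of_le
      (volume : Measure (EuclideanSpace ℝ (Fin n))) hg hsupp hp1 hpn hpq Metric.isBounded_closedBall
    have h2 : eLpNorm (fderiv ℝ g) p volume = eLpNorm (gradient g) p volume :=
      eLpNorm_congr_norm_ae (Filter.Eventually.of_forall (norm_fderiv_eq_norm_gradient g))
    have h3 := eLpNorm_gradient_le hg hs (p := p) (by exact_mod_cast hp2)
    have hq : ENNReal.ofReal (2 + 2 / n) = (q : ℝ≥0∞) := ENNReal.ofReal_eq_coe_nnreal _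
    rw [hq]
    refine h1.trans ?_
    rw [h2, ENNReal.coe_mul, ENNReal.coe_toNNReal, mul_assoc, mul_comm (V ^ _)]
    · gcongr
    · refine ENNReal.rpow_ne_top_of_nonneg ?_ hV
      rw [sub_nonneg]
      simp only [ENNReal.coe_toReal, ENNReal.toReal_ofNat]
      have hp0 : (0 : ℝ) < p := lt_of_lt_of_le one_pos (by exact_mod_cast hp1)
      exact one_div_le_one_div_of_le hp0 (by exact_mod_cast hp2)

/-- Weighted interpolation between `L¹` and `W^{1,2}`: the power of the cutoff lost on the left is
paid for by the `L¹` norm. -/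
theorem exists_interpolation (hn : 1 ≤ n) (R : ℝ) :
    ∃ C : ℝ, 0 < C ∧ ∀ (v ζ : EuclideanSpace ℝ (Fin n) → ℝ) (U : Set (EuclideanSpace ℝ (Fin n))),
      IsOpen U → Metric.closedBall 0 R ⊆ U → ContDiffOn ℝ 1 v U → ContDiff ℝ 1 ζ →
      (∀ x, 0 ≤ ζ x) → (∀ x ∉ Metric.closedBall 0 R, ζ x = 0) →
      ∫ x, v x ^ 2 * ζ x ^ (2 * (n + 1)) ≤
        C * (∫ x in Metric.closedBall 0 R, |v x|) ^ (2 / (n + 2) : ℝ) *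
          (∫ x, ‖gradient (fun y => v y * ζ y ^ (n + 2)) x‖ ^ 2) ^ ((n + 1) / (n + 2) : ℝ) := by
  obtain ⟨C, hC⟩ := exists_eLpNorm_le_eLpNorm_gradient hn R
  have hnR : (1 : ℝ) ≤ n := by exact_mod_cast hn
  -- a = (2 + 2/n)·n/(n+2) is the power of |vζ^{n+2}| left after Hölder. It satisfies a + 2/(n+2) =
  -- 2 and (n+2)a = 2(n+1), which are the powers of v and ζ on the left.
  set a : ℝ := (2 * n + 2) / (n + 2)
  set S : Set (EuclideanSpace ℝ (Fin n)) := Metric.closedBall 0 R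
  have hS : IsCompact S := isCompact_closedBall 0 R
  have ha : 0 < a := by positivity
  refine ⟨(C : ℝ) ^ a + 1, by positivity, fun v ζ U hU hSU hv hζ hζ0 hs => ?_⟩
  have hw : ContDiff ℝ 1 (fun y => v y * ζ y ^ (n + 2)) :=
    contDiff_of_contDiffOn_compact hS.isClosed hU hSU (hv.mul (hζ.pow _).contDiffOn)
      fun x hx => by simp [hs x hx]
  set w := fun y => v y * ζ y ^ (n + 2)
  have hw0 : ∀ x ∉ S, w x = 0 := fun x hx => by simp [w, hs x hx]
  have hsob := hC w hw hw0
  have hwm : AEMeasurable (fun x => ‖w x‖ₑ ^ (2 + 2 / n : ℝ)) volume :=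
    (hw.continuous.measurable.enorm.pow_const _).aemeasurable
  have hvi : IntegrableOn v S := (hv.continuousOn.mono hSU).integrableOn_compact hS
  have hvm : AEMeasurable (S.indicator fun x => ‖v x‖ₑ) volume :=
    (aemeasurable_indicator_iff hS.measurableSet).2 hvi.aestronglyMeasurable.enorm
  have hq0 : (0 : ℝ) < 2 + 2 / n := by positivity
  -- Hölder with weights n/(n+2) and 2/(n+2), splitting v²ζ^{2(n+1)} into |vζ^{n+2}|^a and
  -- |v|^{2/(n+2)}.
  have hH := ENNReal.lintegral_mul_norm_pow_le hwm hvm (p := n / (n + 2)) (q := 2 / (n + 2))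
    (by positivity) (by positivity) (by field_simp)
  have hpt : ∀ x, ENNReal.ofReal (v x ^ 2 * ζ x ^ (2 * (n + 1))) =
      (‖w x‖ₑ ^ (2 + 2 / n : ℝ)) ^ (n / (n + 2) : ℝ) *
        (S.indicator (fun x => ‖v x‖ₑ) x) ^ (2 / (n + 2) : ℝ) := fun x => by
    by_cases hx : x ∈ S
    · rw [indicator_of_mem hx, ← ENNReal.rpow_mul, ← ofReal_norm, ← ofReal_norm,
        ENNReal.ofReal_rpow_of_nonneg (norm_nonneg _) (by positivity),
        ENNReal.ofReal_rpow_of_nonneg (norm_nonneg _) (by positivity),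
        ← ENNReal.ofReal_mul (by positivity)]
      congr 1
      have e1 : ((2 + 2 / n) * (n / (n + 2)) : ℝ) = a := by
        simp only [a]; field_simp
      have e2 : ‖w x‖ = |v x| * ζ x ^ (n + 2) := by
        simp only [w, norm_mul, Real.norm_eq_abs, abs_pow, abs_of_nonneg (hζ0 x)]
      have e3 : (ζ x ^ (n + 2)) ^ a = ζ x ^ (2 * (n + 1)) := by
        rw [← Real.rpow_natCast, ← Real.rpow_mul (hζ0 x), ← Real.rpow_natCast]
        congr 1
        push_cast
        simp only [a]
        field_simp
      have e4 : |v x| ^ a * |v x| ^ (2 / (n + 2) : ℝ) = v x ^ 2 := by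
        rw [← Real.rpow_add_of_nonneg (abs_nonneg _) ha.le (by positivity),
          show a + 2 / (n + 2) = (2 : ℕ) by simp only [a]; push_cast; field_simp; ring,
          Real.rpow_natCast, sq_abs]
      rw [e1, e2, Real.mul_rpow (abs_nonneg _) (pow_nonneg (hζ0 x) _), e3, Real.norm_eq_abs,
        ← e4]
      ring
    · have : (0 : ℝ) < 2 / (n + 2) := by positivity
      rw [indicator_of_notMem hx, hs x hx, ENNReal.zero_rpow_of_pos this]
      simp
  have hgc : Continuous (gradient w) :=
    continuousOn_univ.1 (continuousOn_gradient isOpen_univ hw.contDiffOn)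
  have hg0 := gradient_eq_zero_of_notMem hS.isClosed hw0
  have hgi : Integrable (fun x => ‖gradient w x‖ ^ 2) :=
    integrable_of_continuousOn_compact hS (hgc.norm.pow 2).continuousOn
      fun x hx => by simp [hg0 x hx]
  have hli : Integrable (fun x => v x ^ 2 * ζ x ^ (2 * (n + 1))) :=
    integrable_of_continuousOn_compact hS (((hv.continuousOn.mono hSU).pow 2).mul
      (hζ.continuous.pow _).continuousOn) fun x hx => by simp [hs x hx]
  have hI1 : ∫⁻ x, S.indicator (fun x => ‖v x‖ₑ) x = ENNReal.ofReal (∫ x in S, |v x|) := by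
    rw [lintegral_indicator hS.measurableSet]
    exact (ofReal_integral_norm_eq_lintegral_enorm hvi).symm
  have hI2 : eLpNorm (gradient w) 2 volume = ENNReal.ofReal (∫ x, ‖gradient w x‖ ^ 2) ^ (1 / 2 : ℝ) := by
    rw [eLpNorm_eq_lintegral_rpow_enorm_toReal (by norm_num) (by norm_num),
      ofReal_integral_eq_lintegral_ofReal hgi (Filter.Eventually.of_forall fun x => sq_nonneg _)]
    congr 1
    refine lintegral_congr fun x => ?_
    rw [← ofReal_norm, ENNReal.ofReal_pow (norm_nonneg _)]
    simp
  have hI3 : (∫⁻ x, ‖w x‖ₑ ^ (2 + 2 / n : ℝ)) ^ (n / (n + 2) : ℝ) =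
      eLpNorm w (ENNReal.ofReal (2 + 2 / n)) volume ^ a := by
    rw [eLpNorm_eq_lintegral_rpow_enorm_toReal (by simpa using hq0) (by simp),
      ENNReal.toReal_ofReal hq0.le, ← ENNReal.rpow_mul]
    congr 1
    simp only [a]
    field_simp
  rw [← ENNReal.ofReal_le_ofReal_iff (by positivity),
    ofReal_integral_eq_lintegral_ofReal hli (Filter.Eventually.of_forall fun x =>
      mul_nonneg (sq_nonneg _) (pow_nonneg (hζ0 x) _))]
  simp_rw [hpt]
  refine hH.trans ?_
  have hfin : eLpNorm w (ENNReal.ofReal (2 + 2 / n)) volume ^ a ≤ ENNReal.ofReal ((C : ℝ) ^ a + 1) *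
      ENNReal.ofReal (∫ x, ‖gradient w x‖ ^ 2) ^ ((n + 1) / (n + 2) : ℝ) := by
    refine (ENNReal.rpow_le_rpow hsob ha.le).trans ?_
    calc (C * eLpNorm (gradient w) 2 volume) ^ a
      _ = ENNReal.ofReal ((C : ℝ) ^ a) *
          ENNReal.ofReal (∫ x, ‖gradient w x‖ ^ 2) ^ ((n + 1) / (n + 2) : ℝ) := by
        rw [ENNReal.mul_rpow_of_nonneg _ _ ha.le, hI2, ← ENNReal.rpow_mul,
          ← ENNReal.ofReal_rpow_of_nonneg C.coe_nonneg ha.le, ENNReal.ofReal_coe_nnreal]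
        congr 2
        simp only [a]
        field_simp
      _ ≤ _ := by
        exact mul_le_mul' (ENNReal.ofReal_le_ofReal (by linarith)) le_rfl
  rw [hI1, hI3, ENNReal.ofReal_mul (by positivity), ENNReal.ofReal_mul (by positivity),
    ← ENNReal.ofReal_rpow_of_nonneg (by positivity) (by positivity),
    ← ENNReal.ofReal_rpow_of_nonneg (by positivity) (by positivity), mul_right_comm]
  exact mul_le_mul' hfin le_rfl

/-! ### Algebra of the absorption -/

/-- Absorption of a sublinear power. -/
theorem le_mul_sq_of_le_mul_rpow {m c V D : ℝ} (hm : 1 < m) (hc : 0 ≤ c) (hV : 0 ≤ V) (hD : 0 ≤ D)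
    (h : D ≤ c * V ^ (2 / m) * D ^ ((m - 1) / m)) : D ≤ c ^ m * V ^ 2 := by
  rcases hD.eq_or_lt with rfl | hD
  · positivity
  have hm0 : 0 < m := by linarith
  have h1 : D ^ (1 / m) ≤ c * V ^ (2 / m) := by
    have hp : 0 < D ^ ((m - 1) / m) := Real.rpow_pos_of_pos hD _
    refine le_of_mul_le_mul_right ?_ hp
    rw [← Real.rpow_add hD, show 1 / m + (m - 1) / m = 1 by field_simp; ring, Real.rpow_one]
    exact h
  have h2 := Real.rpow_le_rpow (Real.rpow_nonneg hD.le _) h1 hm0.le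
  rw [← Real.rpow_mul hD.le, one_div_mul_cancel hm0.ne', Real.rpow_one,
    Real.mul_rpow hc (Real.rpow_nonneg hV _), ← Real.rpow_mul hV, div_mul_cancel₀ _ hm0.ne'] at h2
  exact_mod_cast h2

/-- Feeds the absorbed energy bound back into the interpolation inequality to recover the L² term:
the exponents of V add up to 2/m + 2(m-1)/m = 2. -/
theorem rpow_mul_rpow_le_of_le_mul_sq {m c V D : ℝ} (hm : 1 < m) (hc : 0 ≤ c) (hV : 0 ≤ V)
    (hD : 0 ≤ D) (h : D ≤ c ^ m * V ^ 2) :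
    V ^ (2 / m) * D ^ ((m - 1) / m) ≤ c ^ (m - 1) * V ^ 2 := by
  have hm0 : 0 < m := by linarith
  rcases hV.eq_or_lt with rfl | hV
  · rw [Real.zero_rpow (by positivity)]
    simp
  have h1 := Real.rpow_le_rpow hD h (z := (m - 1) / m) (div_nonneg (by linarith) hm0.le)
  rw [Real.mul_rpow (Real.rpow_nonneg hc _) (sq_nonneg V), ← Real.rpow_mul hc,
    mul_div_cancel₀ _ hm0.ne', ← Real.rpow_natCast, ← Real.rpow_mul hV.le] at h1
  refine (mul_le_mul_of_nonneg_left h1 (Real.rpow_nonneg hV.le _)).trans_eq ?_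
  rw [mul_left_comm, ← Real.rpow_add hV, ← Real.rpow_natCast]
  congr 2
  push_cast
  field_simp
  ring

/-! ### The differential inequality for the nonlinearity -/

theorem IsNonlinearity.hasDerivWithinAt {f : ℝ → ℝ} (hf : IsNonlinearity f) {t : ℝ}
    (ht : t ∈ Ico (0 : ℝ) 1) : HasDerivWithinAt f (derivWithin f (Ico 0 1) t) (Ico 0 1) t :=
  (hf.1.differentiableOn (by norm_num) t ht).hasDerivWithinAt

theorem IsNonlinearity.contDiffOn_derivWithin {f : ℝ → ℝ} (hf : IsNonlinearity f) :
    ContDiffOn ℝ 1 (derivWithin f (Ico 0 1)) (Ico 0 1) :=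
  hf.1.derivWithin (uniqueDiffOn_Ico 0 1) (by norm_num)

theorem IsNonlinearity.continuousOn_iteratedDerivWithin {f : ℝ → ℝ} (hf : IsNonlinearity f) :
    ContinuousOn (iteratedDerivWithin 2 f (Ico 0 1)) (Ico 0 1) :=
  hf.1.continuousOn_iteratedDerivWithin le_rfl (uniqueDiffOn_Ico 0 1)

/-- Concavity of `f^{-θ}` is the differential inequality `f'' f ≥ (1 + θ) f'^2`. -/
theorem mul_sq_le_of_concaveOn_rpow {f : ℝ → ℝ} {θ : ℝ} (hθ : 0 < θ) (hf : IsNonlinearity f)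
    {t₀ : ℝ} (ht₀ : 0 ≤ t₀) (hpos : ∀ t ∈ Ioo t₀ 1, 0 < f t)
    (hconc : ConcaveOn ℝ (Ioo t₀ 1) fun t => f t ^ (-θ)) {t : ℝ} (ht : t ∈ Ioo t₀ 1) :
    (1 + θ) * derivWithin f (Ico 0 1) t ^ 2 ≤ iteratedDerivWithin 2 f (Ico 0 1) t * f t := by
  set I : Set ℝ := Ico 0 1
  set f₁ := derivWithin f I
  have hI : ∀ s ∈ Ioo t₀ 1, I ∈ 𝓝 s := fun s hs => Ico_mem_nhds (ht₀.trans_lt hs.1) hs.2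
  have hd : ∀ s ∈ Ioo t₀ 1, HasDerivAt f (f₁ s) s := fun s hs =>
    (hf.hasDerivWithinAt (mem_of_mem_nhds (hI s hs))).hasDerivAt (hI s hs)
  have hd1 : HasDerivAt f₁ (derivWithin f₁ I t) t :=
    (hf.contDiffOn_derivWithin.differentiableOn (by norm_num) t
      (mem_of_mem_nhds (hI t ht))).hasDerivWithinAt.hasDerivAt (hI t ht)
  have hg : ∀ s ∈ Ioo t₀ 1, HasDerivAt (fun t => f t ^ (-θ)) (f₁ s * (-θ) * f s ^ (-θ - 1)) s :=
    fun s hs => (hd s hs).rpow_const (Or.inl (hpos s hs).ne')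
  have hanti : AntitoneOn (deriv fun t => f t ^ (-θ)) (Ioo t₀ 1) :=
    hconc.antitoneOn_deriv fun s hs => (hg s hs).differentiableAt
  have hft := hpos t ht
  have h2 : HasDerivAt (fun s => f₁ s * (-θ) * f s ^ (-θ - 1))
      (derivWithin f₁ I t * (-θ) * f t ^ (-θ - 1) +
        f₁ t * (-θ) * (f₁ t * (-θ - 1) * f t ^ (-θ - 1 - 1))) t :=
    (hd1.mul_const (-θ)).mul ((hd t ht).rpow_const (Or.inl hft.ne'))
  have hev : (deriv fun t => f t ^ (-θ)) =ᶠ[𝓝 t] fun s => f₁ s * (-θ) * f s ^ (-θ - 1) := by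
    filter_upwards [isOpen_Ioo.mem_nhds ht] with s hs using (hg s hs).deriv
  have h3 : derivWithin (deriv fun t => f t ^ (-θ)) (Ioo t₀ 1) t ≤ 0 := hanti.derivWithin_nonpos
  rw [derivWithin_of_isOpen isOpen_Ioo ht, hev.deriv_eq, h2.deriv,
    Real.rpow_sub_one hft.ne' (-θ - 1)] at h3
  have hp : 0 < f t ^ (-θ - 1) := Real.rpow_pos_of_pos hft _
  rw [iteratedDerivWithin_two]
  -- The left side is (f^{-θ})'', which is nonpositive by concavity; the factor in front on the
  -- right is positive and can be divided out.
  have h4 : derivWithin f₁ I t * (-θ) * f t ^ (-θ - 1) +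
        f₁ t * (-θ) * (f₁ t * (-θ - 1) * (f t ^ (-θ - 1) / f t)) =
      (θ * f t ^ (-θ - 1) / f t) * ((1 + θ) * f₁ t ^ 2 - derivWithin f₁ I t * f t) := by
    field_simp
    ring
  rw [h4] at h3
  have h5 : 0 < θ * f t ^ (-θ - 1) / f t := by positivity
  have h6 := nonpos_of_mul_nonpos_right h3 h5
  linarith

theorem exists_crandallRabinowitzBound {f : ℝ → ℝ} {θ : ℝ} (hθ : 0 < θ) (hf : IsNonlinearity f)
    (hc : ConcaveNearOne f θ) : ∃ K : ℝ, 0 ≤ K ∧ CrandallRabinowitzBound f θ K := by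
  obtain ⟨t₀, ht₀, hpos, hconc⟩ := hc
  -- Any point strictly between t₀ and 1 would do: [0, t₁] is compact in [0,1), and beyond t₁
  -- concavity gives the inequality with K = 0.
  set t₁ := (t₀ + 1) / 2
  have h01 : t₀ < t₁ := by simp only [t₁]; linarith [ht₀.2]
  have h11 : t₁ < 1 := by simp only [t₁]; linarith [ht₀.2]
  have hsub : Icc 0 t₁ ⊆ Ico (0 : ℝ) 1 := fun t ht => ⟨ht.1, ht.2.trans_lt h11⟩
  have hcont : ContinuousOn (fun t => (1 + θ) * derivWithin f (Ico 0 1) t ^ 2 -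
      iteratedDerivWithin 2 f (Ico 0 1) t * f t) (Icc 0 t₁) :=
    ((continuousOn_const.mul (hf.contDiffOn_derivWithin.continuousOn.pow 2)).sub
      (hf.continuousOn_iteratedDerivWithin.mul hf.1.continuousOn)).mono hsub
  obtain ⟨K, hK⟩ := isCompact_Icc.exists_bound_of_continuousOn hcont
  refine ⟨max K 0, le_max_right _ _, fun t ht => ?_⟩
  rcases le_or_gt t t₁ with h | h
  · have := (le_abs_self _).trans (hK t ⟨ht.1, h⟩)
    linarith [le_max_left K 0]
  · have := mul_sq_le_of_concaveOn_rpow hθ hf ht₀.1 hpos hconc ⟨h01.trans h, ht.2⟩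
    linarith [le_max_right K 0]

/-! ### L¹ control of f(u) by u -/

/-- Green's second identity for a compactly supported test function. -/
theorem integral_mul_laplacian_comm {S U : Set (EuclideanSpace ℝ (Fin n))} (hS : IsCompact S)
    (hU : IsOpen U) (hSU : S ⊆ U) {v χ : EuclideanSpace ℝ (Fin n) → ℝ}
    (hv : ContDiffOn ℝ 2 v U) (hχ : ContDiff ℝ 2 χ) (hs : ∀ x ∉ S, χ x = 0) :
    ∫ x, χ x * Laplacian.laplacian v x = ∫ x, Laplacian.laplacian χ x * v x := by
  set e := EuclideanSpace.basisFun (Fin n) ℝ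
  have hv1 : ContDiffOn ℝ 1 v U := hv.of_le (by norm_num)
  have hd : ∀ i, ContDiff ℝ 1 (fun y => fderiv ℝ χ y (e i)) := fun i =>
    (hχ.fderiv_right (by norm_num)).clm_apply contDiff_const
  have hd0 : ∀ i, ∀ x ∉ S, fderiv ℝ χ x (e i) = 0 := fun i x hx => by
    rw [← inner_gradient_left, gradient_eq_zero_of_notMem hS.isClosed hs x hx, inner_zero_left]
  have hdd0 : ∀ i, ∀ x ∉ S, fderiv ℝ (fun y => fderiv ℝ χ y (e i)) x (e i) = 0 := fun i x hx => by
    rw [← inner_gradient_left, gradient_eq_zero_of_notMem hS.isClosed (hd0 i) x hx,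
      inner_zero_left]
  rw [green_identity hS hU hSU hv (hχ.of_le (by norm_num)) hs]
  have hR : ∀ x, inner ℝ (gradient χ x) (gradient v x) =
      ∑ i, fderiv ℝ χ x (e i) * fderiv ℝ v x (e i) := fun x => by
    rw [PiLp.inner_apply]
    refine Finset.sum_congr rfl fun i _ => ?_
    rw [gradient_apply, gradient_apply]
    simp [e, mul_comm]
  have hL : ∀ x, Laplacian.laplacian χ x * v x =
      ∑ i, fderiv ℝ (fun y => fderiv ℝ χ y (e i)) x (e i) * v x := fun x => by
    rw [laplacian_eq_sum hχ.contDiffAt, Finset.sum_mul]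
  simp_rw [hR, hL]
  rw [integral_finsetSum, integral_finsetSum, ← Finset.sum_neg_distrib]
  · refine Finset.sum_congr rfl fun i _ => ?_
    -- Second integration by parts, now with the derivative of χ as the compactly supported factor.
    rw [integral_mul_fderiv_eq_neg hS hU hSU hv1 (hd i) (hd0 i), neg_neg]
  · intro i _
    refine integrable_of_continuousOn_compact hS ?_ fun x hx => by rw [hdd0 i x hx, zero_mul]
    exact (((hd i).continuous_fderiv one_ne_zero).clm_apply continuous_const).continuousOn.mul
      (hv.continuousOn.mono hSU)
  · intro i _
    refine integrable_of_continuousOn_compact hS ?_ fun x hx => by rw [hd0 i x hx, zero_mul]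
    exact (hd i).continuous.continuousOn.mul
      (((hv.continuousOn_fderiv_of_isOpen hU (by norm_num)).mono hSU).clm_apply
        continuousOn_const)

/-- The `L¹` norm of `f(u)` is controlled by the `L¹` norm of `u` on a larger ball. -/
theorem exists_setIntegral_le (n : ℕ) {r R : ℝ} (hr : 0 < r) (hrR : r < R) (hR : R < 1) :
    ∃ C : ℝ, 0 ≤ C ∧ ∀ (f : ℝ → ℝ) (u : EuclideanSpace ℝ (Fin n) → ℝ), IsNonlinearity f →
      IsNonnegSolution f (Metric.ball 0 1) u →
      ∫ x in Metric.closedBall 0 r, f (u x) ≤ C * ∫ x in Metric.ball 0 R, u x := by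
  -- The cutoff χ equals 1 on the ball of radius r and vanishes outside radius ρ < R, leaving room
  -- inside the larger ball.
  set ρ := (r + R) / 2
  have h1 : r < ρ := by simp only [ρ]; linarith
  have h2 : ρ < R := by simp only [ρ]; linarith
  let χ : ContDiffBump (0 : EuclideanSpace ℝ (Fin n)) := ⟨r, ρ, hr, h1⟩
  set S : Set (EuclideanSpace ℝ (Fin n)) := Metric.closedBall 0 ρ
  have hS : IsCompact S := isCompact_closedBall 0 ρ
  have hSR : S ⊆ Metric.ball 0 R := Metric.closedBall_subset_ball h2
  have hSU : S ⊆ Metric.ball 0 1 := hSR.trans (Metric.ball_subset_ball hR.le)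
  have hχ : ContDiff ℝ 2 χ := χ.contDiff
  have hs : ∀ x ∉ S, χ x = 0 := fun x hx => χ.zero_of_le_dist (by
    rw [Metric.mem_closedBall, not_le] at hx
    exact hx.le)
  have hΔ0 : ∀ x ∉ S, Laplacian.laplacian (χ : EuclideanSpace ℝ (Fin n) → ℝ) x = 0 := by
    intro x hx
    have hev : (χ : EuclideanSpace ℝ (Fin n) → ℝ) =ᶠ[𝓝 x] fun _ => (0 : ℝ) := by
      filter_upwards [hS.isClosed.isOpen_compl.mem_nhds hx] with y hy using hs y hy
    rw [(InnerProductSpace.laplacian_congr_nhds hev).eq_of_nhds,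
      InnerProductSpace.laplacian_const]
    rfl
  obtain ⟨M, hM⟩ := hS.exists_bound_of_continuousOn
    ((continuousOn_laplacian isOpen_univ hχ.contDiffOn).mono (subset_univ S))
  refine ⟨max M 0, le_max_right _ _, fun f u hf hu => ?_⟩
  have hucont := hu.1.continuousOn
  have hmaps : MapsTo u (Metric.ball 0 1) (Ico 0 1) := fun x hx => hu.2.1 x hx
  have hF : ContinuousOn (fun x => f (u x)) (Metric.ball 0 1) := hf.1.continuousOn.comp hucont hmaps
  have hFi : Integrable (fun x => χ x * f (u x)) :=
    integrable_of_continuousOn_compact hS (hχ.continuous.continuousOn.mul (hF.mono hSU))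
      fun x hx => by rw [hs x hx, zero_mul]
  have hFnn : ∀ x, 0 ≤ χ x * f (u x) := fun x => by
    by_cases hx : x ∈ S
    · exact mul_nonneg χ.nonneg (hf.2 _ (hmaps (hSU hx)))
    · rw [hs x hx, zero_mul]
  have huR : IntegrableOn u S := (hucont.mono hSU).integrableOn_compact hS
  calc ∫ x in Metric.closedBall 0 r, f (u x)
      = ∫ x in Metric.closedBall 0 r, χ x * f (u x) := by
        refine setIntegral_congr_fun Metric.isClosed_closedBall.measurableSet fun x hx => ?_
        simp only [χ.one_of_mem_closedBall hx, one_mul]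
    _ ≤ ∫ x, χ x * f (u x) :=
        setIntegral_le_integral hFi (Filter.Eventually.of_forall hFnn)
    _ = -∫ x, χ x * Laplacian.laplacian u x := by
        rw [← integral_neg]
        congr 1 with x
        by_cases hx : x ∈ S
        · rw [← hu.2.2 x (hSU hx)]
          ring
        · simp [hs x hx]
    _ = ∫ x in S, -(Laplacian.laplacian (χ : EuclideanSpace ℝ (Fin n) → ℝ) x * u x) := by
        rw [integral_mul_laplacian_comm hS Metric.isOpen_ball hSU hu.1 hχ hs, ← integral_neg]
        exact (setIntegral_eq_integral_of_forall_compl_eq_zero fun x hx => by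
          rw [hΔ0 x hx, zero_mul, neg_zero]).symm
    _ ≤ ∫ x in S, max M 0 * u x := by
        refine setIntegral_mono_on ?_ (huR.const_mul _) hS.isClosed.measurableSet fun x hx => ?_
        · exact ((((continuousOn_laplacian isOpen_univ hχ.contDiffOn).mono
            (subset_univ S)).mul (hucont.mono hSU)).integrableOn_compact hS).neg
        · have hb := (neg_le_abs _).trans (hM x hx)
          have := mul_le_mul_of_nonneg_right (hb.trans (le_max_left M 0)) (hu.2.1 x (hSU hx)).1
          linarith
    _ = max M 0 * ∫ x in S, u x := integral_const_mul _ _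
    _ ≤ max M 0 * ∫ x in Metric.ball 0 R, u x := by
        refine mul_le_mul_of_nonneg_left (setIntegral_mono_set ?_ ?_ hSR.eventuallyLE)
          (le_max_right _ _)
        · exact ((hucont.mono (Metric.closedBall_subset_ball hR)).integrableOn_compact
            (isCompact_closedBall 0 R)).mono_set Metric.ball_subset_closedBall
        · exact ae_restrict_of_forall_mem Metric.isOpen_ball.measurableSet
            fun x hx => (hu.2.1 x (Metric.ball_subset_ball hR.le hx)).1

/-! ### Energy estimates -/

theorem norm_smul_add_smul_sq_le {E : Type*} [SeminormedAddCommGroup E] [NormedSpace ℝ E]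
    (a b : ℝ) (p q : E) : ‖a • p + b • q‖ ^ 2 ≤ 2 * (a ^ 2 * ‖p‖ ^ 2) + 2 * (b ^ 2 * ‖q‖ ^ 2) := by
  have h := norm_add_le (a • p) (b • q)
  have h1 : ‖a • p‖ ^ 2 = a ^ 2 * ‖p‖ ^ 2 := by
    rw [norm_smul, mul_pow, Real.norm_eq_abs, sq_abs]
  have h2 : ‖b • q‖ ^ 2 = b ^ 2 * ‖q‖ ^ 2 := by
    rw [norm_smul, mul_pow, Real.norm_eq_abs, sq_abs]
  rw [← h1, ← h2]
  nlinarith [norm_nonneg (a • p + b • q), norm_nonneg (a • p), norm_nonneg (b • q),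
    sq_nonneg (‖a • p‖ - ‖b • q‖)]

/-- `∫ |∇(vη)|² ≤ 2 ∫ |∇v|² η² + 2 ∫ v² |∇η|²`, and the same with the first two terms exchanged. -/
theorem integral_norm_gradient_mul_sq_le {S U : Set (EuclideanSpace ℝ (Fin n))} (hS : IsCompact S)
    (hU : IsOpen U) (hSU : S ⊆ U) {v η : EuclideanSpace ℝ (Fin n) → ℝ}
    (hv : ContDiffOn ℝ 1 v U) (hη : ContDiff ℝ 1 η) (hs : ∀ x ∉ S, η x = 0) :
    (∫ x, ‖gradient (fun y => v y * η y) x‖ ^ 2 ≤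
      2 * (∫ x, η x ^ 2 * ‖gradient v x‖ ^ 2) + 2 * ∫ x, v x ^ 2 * ‖gradient η x‖ ^ 2) ∧
    ∫ x, η x ^ 2 * ‖gradient v x‖ ^ 2 ≤
      2 * (∫ x, ‖gradient (fun y => v y * η y) x‖ ^ 2) +
        2 * ∫ x, v x ^ 2 * ‖gradient η x‖ ^ 2 := by
  have hη0 := gradient_eq_zero_of_notMem hS.isClosed hs
  have hw : ContDiff ℝ 1 (fun y => v y * η y) :=
    contDiff_of_contDiffOn_compact hS.isClosed hU hSU (hv.mul hη.contDiffOn)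
      fun x hx => by simp [hs x hx]
  have hw0 := gradient_eq_zero_of_notMem hS.isClosed (h := fun y => v y * η y)
    fun x hx => by simp [hs x hx]
  have hgv := (continuousOn_gradient hU hv).mono hSU
  have hgη := (continuousOn_gradient isOpen_univ hη.contDiffOn).mono (subset_univ S)
  have hgw := (continuousOn_gradient isOpen_univ hw.contDiffOn).mono (subset_univ S)
  have i1 : Integrable (fun x => ‖gradient (fun y => v y * η y) x‖ ^ 2) :=
    integrable_of_continuousOn_compact hS (hgw.norm.pow 2) fun x hx => by simp [hw0 x hx]
  have i2 : Integrable (fun x => η x ^ 2 * ‖gradient v x‖ ^ 2) :=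
    integrable_of_continuousOn_compact hS ((hη.continuous.continuousOn.pow 2).mul (hgv.norm.pow 2))
      fun x hx => by simp [hs x hx]
  have i3 : Integrable (fun x => v x ^ 2 * ‖gradient η x‖ ^ 2) :=
    integrable_of_continuousOn_compact hS (((hv.continuousOn.mono hSU).pow 2).mul (hgη.norm.pow 2))
      fun x hx => by simp [hη0 x hx]
  have hgm : ∀ x ∈ S, gradient (fun y => v y * η y) x = v x • gradient η x + η x • gradient v x :=
    fun x hx => gradient_mul ((hv.contDiffAt (hU.mem_nhds (hSU hx))).differentiableAt one_ne_zero)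
      (hη.differentiable one_ne_zero x)
  constructor
  · rw [← integral_const_mul, ← integral_const_mul, ← integral_add (i2.const_mul 2) (i3.const_mul 2)]
    refine integral_mono i1 ((i2.const_mul 2).add (i3.const_mul 2)) fun x => ?_
    by_cases hx : x ∈ S
    · simp only [hgm x hx]
      refine (norm_smul_add_smul_sq_le _ _ _ _).trans_eq (add_comm _ _)
    · simp [hw0 x hx, hs x hx, hη0 x hx]
  · rw [← integral_const_mul, ← integral_const_mul, ← integral_add (i1.const_mul 2) (i3.const_mul 2)]
    refine integral_mono i2 ((i1.const_mul 2).add (i3.const_mul 2)) fun x => ?_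
    by_cases hx : x ∈ S
    -- Uses η∇v = ∇(vη) - v∇η.
    · have h := norm_smul_add_smul_sq_le 1 (-v x) (gradient (fun y => v y * η y) x) (gradient η x)
      rw [one_smul] at h
      have e : gradient (fun y => v y * η y) x + -v x • gradient η x = η x • gradient v x := by
        rw [hgm x hx]
        module
      rw [e, norm_smul, mul_pow, Real.norm_eq_abs, sq_abs] at h
      simpa using h
    · simp [hw0 x hx, hs x hx, hη0 x hx]

/-- The Crandall–Rabinowitz argument: stability tested with `f(u) η`. -/
theorem integral_sq_mul_norm_gradient_comp_le {f : ℝ → ℝ} {θ K : ℝ} (hθ : 0 < θ)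
    {S U : Set (EuclideanSpace ℝ (Fin n))} (hS : IsCompact S) (hU : IsOpen U) (hSU : S ⊆ U)
    {u η : EuclideanSpace ℝ (Fin n) → ℝ} (hf : IsNonlinearity f)
    (hK : CrandallRabinowitzBound f θ K) (hu : IsNonnegSolution f U u) (hst : IsStable f U u)
    (hη : ContDiff ℝ 2 η) (hs : ∀ x ∉ S, η x = 0) :
    ∫ x, η x ^ 2 * ‖gradient (fun y => f (u y)) x‖ ^ 2 ≤
      (∫ x, f (u x) ^ 2 * ‖gradient η x‖ ^ 2) + K * ∫ x, η x ^ 2 * ‖gradient u x‖ ^ 2 := by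
  set I : Set ℝ := Ico 0 1
  have hm : MapsTo u U I := fun x hx => hu.2.1 x hx
  have hu1 : ContDiffOn ℝ 1 u U := hu.1.of_le (by norm_num)
  have hη1 : ContDiff ℝ 1 η := hη.of_le (by norm_num)
  have hF : ContDiffOn ℝ 2 (fun y => f (u y)) U := hf.1.comp hu.1 hm
  have hF1 : ContDiffOn ℝ 1 (fun y => f (u y)) U := hF.of_le (by norm_num)
  have hf1c : ContinuousOn (fun x => derivWithin f I (u x)) U :=
    hf.contDiffOn_derivWithin.continuousOn.comp hu1.continuousOn hm
  have hf2c : ContinuousOn (fun x => iteratedDerivWithin 2 f I (u x)) U :=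
    hf.continuousOn_iteratedDerivWithin.comp hu1.continuousOn hm
  have hw : ContDiff ℝ 1 (fun y => f (u y) * η y) :=
    contDiff_of_contDiffOn_compact hS.isClosed hU hSU (hF1.mul hη1.contDiffOn)
      fun x hx => by simp [hs x hx]
  have hws : ∀ x ∉ S, f (u x) * η x = 0 := fun x hx => by simp [hs x hx]
  have hw0 := gradient_eq_zero_of_notMem hS.isClosed (h := fun y => f (u y) * η y) hws
  have hst' := hst.integral_nonneg hU hS hSU hf1c hw hws
  have hid := integral_norm_gradient_mul_sq hS hU hSU hF hη hs
  have cη := hη.continuous.continuousOn (s := S)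
  have cF := hF.continuousOn.mono hSU
  have cf1 := hf1c.mono hSU
  have cf2 := hf2c.mono hSU
  have cgu := (continuousOn_gradient hU hu1).mono hSU
  have cgF := (continuousOn_gradient hU hF1).mono hSU
  have cgw := (continuousOn_gradient isOpen_univ hw.contDiffOn).mono (subset_univ S)
  have i1 : Integrable (fun x => ‖gradient (fun y => f (u y) * η y) x‖ ^ 2) :=
    integrable_of_continuousOn_compact hS (cgw.norm.pow 2) fun x hx => by simp [hw0 x hx]
  have i2 : Integrable (fun x => derivWithin f I (u x) * (f (u x) * η x) ^ 2) :=
    integrable_of_continuousOn_compact hS (cf1.mul ((cF.mul cη).pow 2))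
      fun x hx => by simp [hs x hx]
  have i3 : Integrable (fun x => iteratedDerivWithin 2 f I (u x) * f (u x) *
      ‖gradient u x‖ ^ 2 * η x ^ 2) :=
    integrable_of_continuousOn_compact hS (((cf2.mul cF).mul (cgu.norm.pow 2)).mul (cη.pow 2))
      fun x hx => by simp [hs x hx]
  have i4 : Integrable (fun x => η x ^ 2 * ‖gradient (fun y => f (u y)) x‖ ^ 2) :=
    integrable_of_continuousOn_compact hS ((cη.pow 2).mul (cgF.norm.pow 2))
      fun x hx => by simp [hs x hx]
  have i5 : Integrable (fun x => η x ^ 2 * ‖gradient u x‖ ^ 2) :=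
    integrable_of_continuousOn_compact hS ((cη.pow 2).mul (cgu.norm.pow 2))
      fun x hx => by simp [hs x hx]
  -- The first term on the right is exactly the potential term of the stability inequality for ξ =
  -- f(u)η, so it cancels when `hst'` and `hid` are combined.
  have hlap : (fun x => -Laplacian.laplacian (fun y => f (u y)) x * f (u x) * η x ^ 2) = fun x =>
      derivWithin f I (u x) * (f (u x) * η x) ^ 2 -
        iteratedDerivWithin 2 f I (u x) * f (u x) * ‖gradient u x‖ ^ 2 * η x ^ 2 := by
    ext x
    by_cases hx : x ∈ S
    · rw [laplacian_comp_of_mapsTo (uniqueDiffOn_Ico 0 1) hU hm (hSU hx) hf.1 hu.1]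
      rw [neg_eq_iff_eq_neg.1 (hu.2.2 x (hSU hx))]
      ring
    · simp [hs x hx]
  rw [integral_sub i1 i2] at hst'
  rw [hlap, integral_sub i2 i3] at hid
  -- Only f''f ≥ f'² - K is needed here; the nonnegative surplus θf'² is discarded.
  have hpt : ∀ x, η x ^ 2 * ‖gradient (fun y => f (u y)) x‖ ^ 2 ≤
      iteratedDerivWithin 2 f I (u x) * f (u x) * ‖gradient u x‖ ^ 2 * η x ^ 2 +
        K * (η x ^ 2 * ‖gradient u x‖ ^ 2) := fun x => by
    by_cases hx : x ∈ S
    · have hxU := hSU hx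
      rw [gradient_comp_of_mapsTo hU hm hxU (hf.1.differentiableOn (by norm_num) _ (hm hxU))
        ((hu1.contDiffAt (hU.mem_nhds hxU)).differentiableAt one_ne_zero), norm_smul, mul_pow,
        Real.norm_eq_abs, sq_abs]
      have h1 := hK (u x) (hm hxU)
      have h2 : 0 ≤ θ * derivWithin f I (u x) ^ 2 := by positivity
      have h3 : derivWithin f I (u x) ^ 2 ≤ iteratedDerivWithin 2 f I (u x) * f (u x) + K := by
        linarith
      have h4 : 0 ≤ η x ^ 2 * ‖gradient u x‖ ^ 2 := by positivity
      have := mul_le_mul_of_nonneg_right h3 h4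
      linarith
    · simp [hs x hx]
  have hfin := integral_mono i4 (i3.add (i5.const_mul K)) hpt
  simp only [Pi.add_apply] at hfin
  rw [integral_add i3 (i5.const_mul K), integral_const_mul] at hfin
  linarith

/-- Quadratic energy estimate for `f(u)`, localized by a power of the cutoff `ζ`. -/
theorem integral_norm_gradient_add_le {f : ℝ → ℝ} {θ K M : ℝ} (hθ : 0 < θ) (hK0 : 0 ≤ K)
    (hM0 : 0 ≤ M) {S U : Set (EuclideanSpace ℝ (Fin n))} (hS : IsCompact S) (hU : IsOpen U)
    (hSU : S ⊆ U) {u η w : EuclideanSpace ℝ (Fin n) → ℝ} (hf : IsNonlinearity f)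
    (hK : CrandallRabinowitzBound f θ K) (hu : IsNonnegSolution f U u) (hst : IsStable f U u)
    (hη : ContDiff ℝ 2 η) (hs : ∀ x ∉ S, η x = 0) (hw : ContinuousOn w S)
    (hw0 : ∀ x ∉ S, w x = 0) (hηw : ∀ x, η x ^ 2 ≤ w x)
    (hgw : ∀ x, ‖gradient η x‖ ^ 2 ≤ M * w x) :
    (∫ x, ‖gradient (fun y => f (u y) * η y) x‖ ^ 2) +
        ∫ x, ‖gradient (fun y => u y * η y) x‖ ^ 2 ≤
      (4 + 8 * K) * (1 + M) * ((∫ x, f (u x) ^ 2 * w x) + ∫ x, u x ^ 2 * w x) := by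
  have hm : MapsTo u U (Ico 0 1) := fun x hx => hu.2.1 x hx
  have hu1 : ContDiffOn ℝ 1 u U := hu.1.of_le (by norm_num)
  have hη1 : ContDiff ℝ 1 η := hη.of_le (by norm_num)
  have hF : ContDiffOn ℝ 2 (fun y => f (u y)) U := hf.1.comp hu.1 hm
  have hF1 : ContDiffOn ℝ 1 (fun y => f (u y)) U := hF.of_le (by norm_num)
  have hη0 := gradient_eq_zero_of_notMem hS.isClosed hs
  have cη := hη.continuous.continuousOn (s := S)
  have cgη := (continuousOn_gradient isOpen_univ hη1.contDiffOn).mono (subset_univ S)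
  have cF := hF.continuousOn.mono hSU
  have cu := hu1.continuousOn.mono hSU
  have iw : ∀ v : EuclideanSpace ℝ (Fin n) → ℝ, ContinuousOn v S →
      Integrable (fun x => v x ^ 2 * w x) := fun v hv =>
    integrable_of_continuousOn_compact hS ((hv.pow 2).mul hw) fun x hx => by simp [hw0 x hx]
  have ig : ∀ v : EuclideanSpace ℝ (Fin n) → ℝ, ContinuousOn v S →
      Integrable (fun x => v x ^ 2 * ‖gradient η x‖ ^ 2) := fun v hv =>
    integrable_of_continuousOn_compact hS ((hv.pow 2).mul (cgη.norm.pow 2))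
      fun x hx => by simp [hη0 x hx]
  have hgle : ∀ v : EuclideanSpace ℝ (Fin n) → ℝ, ContinuousOn v S →
      ∫ x, v x ^ 2 * ‖gradient η x‖ ^ 2 ≤ M * ∫ x, v x ^ 2 * w x := fun v hv => by
    rw [← integral_const_mul]
    refine integral_mono (ig v hv) ((iw v hv).const_mul M) fun x => ?_
    have := mul_le_mul_of_nonneg_left (hgw x) (sq_nonneg (v x))
    simp only
    linarith
  have hw_nonneg : ∀ x, 0 ≤ w x := fun x => (sq_nonneg _).trans (hηw x)
  have hnn : ∀ v : EuclideanSpace ℝ (Fin n) → ℝ, 0 ≤ ∫ x, v x ^ 2 * w x := fun v =>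
    integral_nonneg fun x => mul_nonneg (sq_nonneg _) (hw_nonneg x)
  have hA := (integral_norm_gradient_mul_sq_le hS hU hSU hF1 hη1 hs).1
  have hB := (integral_norm_gradient_mul_sq_le hS hU hSU hu1 hη1 hs).2
  have hCR := integral_sq_mul_norm_gradient_comp_le hθ hS hU hSU hf hK hu hst hη hs
  have hid := integral_norm_gradient_mul_sq hS hU hSU hu.1 hη hs
  -- The equation turns -Δu into f(u), and f(u)u ≤ (f(u)² + u²)/2.
  have hFu : ∫ x, -Laplacian.laplacian u x * u x * η x ^ 2 ≤
      (1 / 2) * (∫ x, f (u x) ^ 2 * w x) + (1 / 2) * ∫ x, u x ^ 2 * w x := by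
    have e : (fun x => -Laplacian.laplacian u x * u x * η x ^ 2) =
        fun x => f (u x) * u x * η x ^ 2 := by
      ext x
      by_cases hx : x ∈ S
      · rw [hu.2.2 x (hSU hx)]
      · simp [hs x hx]
    rw [e, ← integral_const_mul, ← integral_const_mul,
      ← integral_add ((iw _ cF).const_mul _) ((iw _ cu).const_mul _)]
    refine integral_mono ?_ (((iw _ cF).const_mul _).add ((iw _ cu).const_mul _)) fun x => ?_
    · exact integrable_of_continuousOn_compact hS ((cF.mul cu).mul (cη.pow 2))
        fun x hx => by simp [hs x hx]
    · have h1 : f (u x) * u x * η x ^ 2 ≤ (f (u x) ^ 2 + u x ^ 2) / 2 * η x ^ 2 :=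
        mul_le_mul_of_nonneg_right (by nlinarith [sq_nonneg (f (u x) - u x)]) (sq_nonneg _)
      have h2 : (f (u x) ^ 2 + u x ^ 2) / 2 * η x ^ 2 ≤ (f (u x) ^ 2 + u x ^ 2) / 2 * w x :=
        mul_le_mul_of_nonneg_left (hηw x) (by positivity)
      simp only
      linarith
  have hgF := hgle _ cF
  have hgu := hgle _ cu
  have hIF := hnn fun x => f (u x)
  have hIu := hnn u
  set IF := ∫ x, f (u x) ^ 2 * w x
  set Iu := ∫ x, u x ^ 2 * w x
  set GF := ∫ x, f (u x) ^ 2 * ‖gradient η x‖ ^ 2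
  set Gu := ∫ x, u x ^ 2 * ‖gradient η x‖ ^ 2
  set DF := ∫ x, ‖gradient (fun y => f (u y) * η y) x‖ ^ 2
  set Du := ∫ x, ‖gradient (fun y => u y * η y) x‖ ^ 2
  set Pu := ∫ x, η x ^ 2 * ‖gradient u x‖ ^ 2
  -- With X = IF + Iu, the estimates combine to DF ≤ 4·GF + 2K·Pu, where GF ≤ M·IF and Pu ≤ 4(1+M)X.
  -- This explains 4 and 8K; Du fits into the slack of 4(1+M)X.
  have hDu : Du ≤ (1 + M) * (IF + Iu) := by nlinarith [mul_nonneg hM0 hIF]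
  have hPu : Pu ≤ 4 * ((1 + M) * (IF + Iu)) := by nlinarith [mul_nonneg hM0 hIF]
  have hKP := mul_le_mul_of_nonneg_left hPu hK0
  have hMF : M * IF ≤ (1 + M) * (IF + Iu) - (IF + Iu) := by nlinarith [mul_nonneg hM0 hIu]
  linarith [hDu, hKP, hMF]

/-- A `W^{1,2}` bound for `f(u) η`, with a fixed cutoff `η`, in terms of the `L¹` norm of `u`. -/
theorem exists_energy_bound (hn : 1 ≤ n) {θ K : ℝ} (hθ : 0 < θ) (hK0 : 0 ≤ K) :
    ∃ η : EuclideanSpace ℝ (Fin n) → ℝ, ContDiff ℝ 2 η ∧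
      (∀ x ∈ Metric.closedBall 0 (1 / 2), η x = 1) ∧ (∀ x ∉ Metric.closedBall 0 (5 / 8), η x = 0) ∧
      ∃ C : ℝ, 0 < C ∧ ∀ (f : ℝ → ℝ) (u : EuclideanSpace ℝ (Fin n) → ℝ), IsNonlinearity f →
        CrandallRabinowitzBound f θ K → IsNonnegSolution f (Metric.ball 0 1) u →
        IsStable f (Metric.ball 0 1) u →
        (∫ x, (f (u x) * η x) ^ 2) + ∫ x, ‖gradient (fun y => f (u y) * η y) x‖ ^ 2 ≤
          C * (∫ x in Metric.ball 0 (3 / 4), u x) ^ 2 := by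
  let ζ : ContDiffBump (0 : EuclideanSpace ℝ (Fin n)) := ⟨1 / 2, 5 / 8, by norm_num, by norm_num⟩
  set S : Set (EuclideanSpace ℝ (Fin n)) := Metric.closedBall 0 (5 / 8)
  have hS : IsCompact S := isCompact_closedBall 0 _
  have hSU : S ⊆ Metric.ball 0 1 := Metric.closedBall_subset_ball (by norm_num)
  have hSR : S ⊆ Metric.ball 0 (3 / 4) := Metric.closedBall_subset_ball (by norm_num)
  have hζ : ContDiff ℝ 2 ζ := ζ.contDiff
  have hζ1 : ContDiff ℝ 1 ζ := ζ.contDiff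
  have hζs : ∀ x ∉ S, ζ x = 0 := fun x hx => ζ.zero_of_le_dist (by
    rw [Metric.mem_closedBall, not_le] at hx
    exact hx.le)
  obtain ⟨Z, hZ⟩ := hS.exists_bound_of_continuousOn
    ((continuousOn_gradient isOpen_univ hζ1.contDiffOn).mono (subset_univ S))
  have hgζ0 := gradient_eq_zero_of_notMem hS.isClosed hζs
  -- From ∇(ζ^{n+2}) = (n+2)ζ^{n+1}∇ζ with |∇ζ| ≤ Z: the gradient loses only one power of ζ, which
  -- the interpolation weight ζ^{2(n+1)} tolerates.
  set M : ℝ := (((n + 2 : ℕ) : ℝ) * Z) ^ 2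
  have hM0 : 0 ≤ M := sq_nonneg _
  have hgη : ∀ x, ‖gradient (fun y => ζ y ^ (n + 2)) x‖ ^ 2 ≤ M * ζ x ^ (2 * (n + 1)) := by
    intro x
    have e : gradient (fun y => ζ y ^ (n + 2)) x =
        (((n + 2 : ℕ) : ℝ) * ζ x ^ (n + 1)) • gradient ζ x := by
      simp only [gradient]
      rw [fderiv_fun_pow _ (hζ1.differentiable one_ne_zero x)]
      simp
    rw [e, norm_smul, mul_pow, Real.norm_eq_abs, sq_abs]
    by_cases hx : x ∈ S
    · have h1 : ‖gradient ζ x‖ ^ 2 ≤ Z ^ 2 := pow_le_pow_left₀ (norm_nonneg _) (hZ x hx) 2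
      calc (((n + 2 : ℕ) : ℝ) * ζ x ^ (n + 1)) ^ 2 * ‖gradient ζ x‖ ^ 2
          ≤ (((n + 2 : ℕ) : ℝ) * ζ x ^ (n + 1)) ^ 2 * Z ^ 2 :=
            mul_le_mul_of_nonneg_left h1 (sq_nonneg _)
        _ = M * ζ x ^ (2 * (n + 1)) := by
            simp only [M]
            ring
    · simp [hζs x hx, hgζ0 x hx]
  obtain ⟨C₁, hC₁, hint⟩ := exists_interpolation hn (5 / 8 : ℝ)
  obtain ⟨C₂, hC₂, hL1⟩ := exists_setIntegral_le n (r := 5 / 8) (R := 3 / 4) (by norm_num)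
    (by norm_num) (by norm_num)
  refine ⟨fun x => ζ x ^ (n + 2), hζ.pow _, fun x hx => ?_, fun x hx => ?_, ?_⟩
  · simp [ζ.one_of_mem_closedBall hx]
  · simp [hζs x hx]
  set m : ℝ := n + 2 with hm
  have hm1 : 1 < m := by linarith [(Nat.cast_nonneg n : (0 : ℝ) ≤ n)]
  have hmn : (n : ℝ) + 1 = m - 1 := by rw [hm]; ring
  have hm0 : 0 < m := by linarith
  -- The energy constant times 2C₁, since the interpolation inequality is applied to both f(u) and
  -- u.
  set c : ℝ := (4 + 8 * K) * (1 + M) * (2 * C₁)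
  have hc : 0 ≤ c := by positivity
  refine ⟨(C₁ * c ^ (m - 1) + c ^ m) * (1 + C₂) ^ 2 + 1, by positivity, fun f u hf hK hu hst => ?_⟩
  have hmaps : MapsTo u (Metric.ball 0 1) (Ico 0 1) := fun x hx => hu.2.1 x hx
  have hu1 : ContDiffOn ℝ 1 u (Metric.ball 0 1) := hu.1.of_le (by norm_num)
  have hF1 : ContDiffOn ℝ 1 (fun y => f (u y)) (Metric.ball 0 1) :=
    (hf.1.comp hu.1 hmaps).of_le (by norm_num)
  have hE := integral_norm_gradient_add_le hθ hK0 hM0 hS Metric.isOpen_ball hSU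
    (η := fun y => ζ y ^ (n + 2)) (w := fun y => ζ y ^ (2 * (n + 1))) hf hK hu hst (hζ.pow _)
    (fun x hx => by simp [hζs x hx]) (hζ.continuous.pow _).continuousOn
    (fun x hx => by simp [hζs x hx])
    (fun x => by
      rw [← pow_mul]
      exact pow_le_pow_of_le_one ζ.nonneg ζ.le_one (by omega)) hgη
  have hIF := hint (fun y => f (u y)) ζ (Metric.ball 0 1) Metric.isOpen_ball hSU hF1 hζ1
    (fun x => ζ.nonneg) hζs
  have hIu := hint u ζ (Metric.ball 0 1) Metric.isOpen_ball hSU hu1 hζ1 (fun x => ζ.nonneg) hζs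
  have hFL := hL1 f u hf hu
  have hFabs : ∫ x in S, |f (u x)| = ∫ x in S, f (u x) :=
    setIntegral_congr_fun hS.measurableSet fun x hx =>
      abs_of_nonneg (hf.2 _ (hmaps (hSU hx)))
  have huabs : ∫ x in S, |u x| = ∫ x in S, u x :=
    setIntegral_congr_fun hS.measurableSet fun x hx => abs_of_nonneg (hu.2.1 x (hSU hx)).1
  have hunn : ∀ x ∈ Metric.ball (0 : EuclideanSpace ℝ (Fin n)) (3 / 4), 0 ≤ u x := fun x hx =>
    (hu.2.1 x (Metric.ball_subset_ball (by norm_num) hx)).1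
  have huL : ∫ x in S, u x ≤ ∫ x in Metric.ball 0 (3 / 4), u x := by
    refine setIntegral_mono_set ?_ (ae_restrict_of_forall_mem Metric.isOpen_ball.measurableSet hunn)
      hSR.eventuallyLE
    exact ((hu1.continuousOn.mono (Metric.closedBall_subset_ball (by norm_num))).integrableOn_compact
      (isCompact_closedBall 0 (3 / 4))).mono_set Metric.ball_subset_closedBall
  have hFnn : 0 ≤ ∫ x in S, f (u x) :=
    setIntegral_nonneg hS.measurableSet fun x hx => hf.2 _ (hmaps (hSU hx))
  have hunn' : 0 ≤ ∫ x in S, u x :=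
    setIntegral_nonneg hS.measurableSet fun x hx => (hu.2.1 x (hSU hx)).1
  have hηle : ∫ x, (f (u x) * ζ x ^ (n + 2)) ^ 2 ≤ ∫ x, f (u x) ^ 2 * ζ x ^ (2 * (n + 1)) := by
    refine integral_mono ?_ ?_ fun x => ?_
    · exact integrable_of_continuousOn_compact hS (((hF1.continuousOn.mono hSU).mul
        (hζ.continuous.pow _).continuousOn).pow 2) fun x hx => by simp [hζs x hx]
    · exact integrable_of_continuousOn_compact hS (((hF1.continuousOn.mono hSU).pow 2).mul
        (hζ.continuous.pow _).continuousOn) fun x hx => by simp [hζs x hx]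
    · simp only [mul_pow]
      rw [← pow_mul]
      exact mul_le_mul_of_nonneg_left (pow_le_pow_of_le_one ζ.nonneg ζ.le_one (by omega))
        (sq_nonneg _)
  have hDF : 0 ≤ ∫ x, ‖gradient (fun y => f (u y) * ζ y ^ (n + 2)) x‖ ^ 2 :=
    integral_nonneg fun x => sq_nonneg _
  have hDu : 0 ≤ ∫ x, ‖gradient (fun y => u y * ζ y ^ (n + 2)) x‖ ^ 2 :=
    integral_nonneg fun x => sq_nonneg _
  rw [hFabs] at hIF
  rw [huabs] at hIu
  rw [hmn] at hIF hIu
  set DF := ∫ x, ‖gradient (fun y => f (u y) * ζ y ^ (n + 2)) x‖ ^ 2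
  set Du := ∫ x, ‖gradient (fun y => u y * ζ y ^ (n + 2)) x‖ ^ 2
  set W := ∫ x in Metric.ball 0 (3 / 4), u x
  set VF := ∫ x in S, f (u x)
  set Vu := ∫ x in S, u x
  set V := VF + Vu
  set D := DF + Du
  have hV0 : 0 ≤ V := by positivity
  have hD0 : 0 ≤ D := by positivity
  -- The energies of f(u) and u are coupled through K, so absorption is done for their sum: both
  -- interpolation bounds are enlarged to the common quantity in V and D.
  have hmono : ∀ V' D', 0 ≤ V' → 0 ≤ D' → V' ≤ V → D' ≤ D →
      C₁ * V' ^ (2 / m) * D' ^ ((m - 1) / m) ≤ C₁ * (V ^ (2 / m) * D ^ ((m - 1) / m)) := by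
    intro V' D' h1 h2 h3 h4
    rw [mul_assoc]
    exact mul_le_mul_of_nonneg_left (mul_le_mul (Real.rpow_le_rpow h1 h3 (by positivity))
      (Real.rpow_le_rpow h2 h4 (div_nonneg (by linarith) hm0.le)) (Real.rpow_nonneg h2 _)
      (Real.rpow_nonneg hV0 _)) hC₁.le
  have hIF' := hIF.trans (hmono VF DF hFnn hDF (by simp only [V]; linarith)
    (by simp only [D]; linarith))
  have hIu' := hIu.trans (hmono Vu Du hunn' hDu (by simp only [V]; linarith)
    (by simp only [D]; linarith))
  have hDle : D ≤ c * V ^ (2 / m) * D ^ ((m - 1) / m) := by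
    refine hE.trans ((mul_le_mul_of_nonneg_left (add_le_add hIF' hIu') (by positivity)).trans_eq ?_)
    simp only [c]
    ring
  have hDsq := le_mul_sq_of_le_mul_rpow hm1 hc hV0 hD0 hDle
  have hVD := rpow_mul_rpow_le_of_le_mul_sq hm1 hc hV0 hD0 hDsq
  -- V = VF + Vu ≤ C₂W + W, by the L¹ bound for f(u) and the inclusion of S in the ball of radius
  -- 3/4.
  have hVW : V ^ 2 ≤ ((1 + C₂) * W) ^ 2 :=
    pow_le_pow_left₀ hV0 (by simp only [V]; linarith) 2
  have h1 : ∫ x, (f (u x) * ζ x ^ (n + 2)) ^ 2 ≤ C₁ * c ^ (m - 1) * V ^ 2 :=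
    (hηle.trans hIF').trans ((mul_le_mul_of_nonneg_left hVD hC₁.le).trans_eq (by ring))
  have h2 : DF ≤ c ^ m * V ^ 2 := le_trans (by simp only [D]; linarith) hDsq
  have h3 : (C₁ * c ^ (m - 1) + c ^ m) * V ^ 2 ≤
      (C₁ * c ^ (m - 1) + c ^ m) * ((1 + C₂) * W) ^ 2 :=
    mul_le_mul_of_nonneg_left hVW (by positivity)
  calc (∫ x, (f (u x) * ζ x ^ (n + 2)) ^ 2) + DF
      ≤ (C₁ * c ^ (m - 1) + c ^ m) * ((1 + C₂) * W) ^ 2 := by linarith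
    _ ≤ ((C₁ * c ^ (m - 1) + c ^ m) * (1 + C₂) ^ 2 + 1) * W ^ 2 := by
      nlinarith [sq_nonneg W]

/-! ### Weak gradients and the Sobolev norm -/

/-- The gradient of a globally `C¹` function is its weak gradient. -/
theorem hasWeakGradient_of_contDiff {U : Set (EuclideanSpace ℝ (Fin n))} (hU : IsOpen U)
    {v w : EuclideanSpace ℝ (Fin n) → ℝ} (hw : ContDiff ℝ 1 w) (hvw : EqOn v w U) :
    HasWeakGradient U v (gradient w) := by
  have hgw : Continuous (gradient w) :=
    continuousOn_univ.1 (continuousOn_gradient isOpen_univ hw.contDiffOn)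
  refine ⟨(hw.continuous.continuousOn.congr hvw).locallyIntegrableOn hU.measurableSet,
    hgw.continuousOn.locallyIntegrableOn hU.measurableSet, fun φ hφ i => ?_⟩
  obtain ⟨hφ, hφc, hφU⟩ := hφ
  have hφ1 : ContDiff ℝ 1 φ := hφ.of_le (by simp)
  have hφ0 : ∀ x ∉ tsupport φ, φ x = 0 := fun x hx => image_eq_zero_of_notMem_tsupport hx
  have hgφ0 := gradient_eq_zero_of_notMem hφc.isCompact.isClosed hφ0
  have h := integral_mul_fderiv_eq_neg hφc.isCompact isOpen_univ (subset_univ _)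
    hw.contDiffOn hφ1 hφ0 (EuclideanSpace.basisFun (Fin n) ℝ i)
  have e1 : ∫ x in U, v x * gradient φ x i =
      ∫ x, fderiv ℝ φ x (EuclideanSpace.basisFun (Fin n) ℝ i) * w x := by
    rw [setIntegral_eq_integral_of_forall_compl_eq_zero fun x hx => by
      rw [hgφ0 x fun hx' => hx (hφU hx'), PiLp.zero_apply, mul_zero]]
    congr 1 with x
    by_cases hx : x ∈ U
    · rw [← gradient_apply, hvw hx, mul_comm]
    · rw [← gradient_apply, hgφ0 x fun hx' => hx (hφU hx'), PiLp.zero_apply, mul_zero, zero_mul]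
  have e2 : ∫ x in U, gradient w x i * φ x =
      ∫ x, φ x * fderiv ℝ w x (EuclideanSpace.basisFun (Fin n) ℝ i) := by
    rw [setIntegral_eq_integral_of_forall_compl_eq_zero fun x hx => by
      rw [hφ0 x fun hx' => hx (hφU hx'), mul_zero]]
    congr 1 with x
    rw [← gradient_apply, mul_comm]
  rw [e1, e2, h, neg_neg]

theorem eLpNorm_two_restrict_sq_le {G : Type*} [NormedAddCommGroup G]
    {U : Set (EuclideanSpace ℝ (Fin n))} {g : EuclideanSpace ℝ (Fin n) → G}
    (hg : Integrable fun x => ‖g x‖ ^ 2) :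
    eLpNorm g 2 (volume.restrict U) ^ 2 ≤ ENNReal.ofReal (∫ x, ‖g x‖ ^ 2) := by
  refine (pow_le_pow_left' (eLpNorm_restrict_le g 2 volume U) 2).trans_eq ?_
  rw [eLpNorm_eq_lintegral_rpow_enorm_toReal (by norm_num) (by norm_num),
    ofReal_integral_eq_lintegral_ofReal hg (Filter.Eventually.of_forall fun x => sq_nonneg _),
    ← ENNReal.rpow_natCast, ← ENNReal.rpow_mul]
  simp only [ENNReal.toReal_ofNat, Nat.cast_ofNat, one_div, inv_mul_cancel₀ (two_ne_zero' ℝ),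
    ENNReal.rpow_one]
  refine lintegral_congr fun x => ?_
  rw [← ofReal_norm, ENNReal.ofReal_pow (norm_nonneg _)]
  simp

end MEMS

theorem lemma3p1 (n : ℕ) (hn : 1 ≤ n) (θ : ℝ) (hθ : 0 < θ) :
    (∀ f : ℝ → ℝ, MEMS.IsNonlinearity f → MEMS.ConcaveNearOne f θ →
      ∃ K : ℝ, 0 ≤ K ∧ MEMS.CrandallRabinowitzBound f θ K) ∧
    ∀ K : ℝ, 0 ≤ K → ∃ C : ℝ, 0 < C ∧
      ∀ (f : ℝ → ℝ) (u : EuclideanSpace ℝ (Fin n) → ℝ),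
        MEMS.IsNonlinearity f → MEMS.ConcaveNearOne f θ → MEMS.CrandallRabinowitzBound f θ K →
        MEMS.IsNonnegSolution f (Metric.ball 0 1) u → MEMS.IsStable f (Metric.ball 0 1) u →
        MEMS.sobolevNorm (Metric.ball 0 (1 / 2)) (fun x => f (u x)) ≤
          ENNReal.ofReal C * eLpNorm u 1 (volume.restrict (Metric.ball 0 (3 / 4))) := by
  refine ⟨fun f hf hc => MEMS.exists_crandallRabinowitzBound hθ hf hc, fun K hK0 => ?_⟩
  obtain ⟨η, hη, hη1, hη0, C, hC, hbound⟩ := MEMS.exists_energy_bound hn hθ hK0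
  -- The energy bound is quadratic in the L¹ norm, hence the square root.
  refine ⟨√C, Real.sqrt_pos.2 hC, fun f u hf _ hK hu hst => ?_⟩
  have hE := hbound f u hf hK hu hst
  set S : Set (EuclideanSpace ℝ (Fin n)) := Metric.closedBall 0 (5 / 8)
  have hS : IsCompact S := isCompact_closedBall 0 _
  have hSU : S ⊆ Metric.ball 0 1 := Metric.closedBall_subset_ball (by norm_num)
  have hmaps : MapsTo u (Metric.ball 0 1) (Ico 0 1) := fun x hx => hu.2.1 x hx
  have hF1 : ContDiffOn ℝ 1 (fun y => f (u y)) (Metric.ball 0 1) :=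
    (hf.1.comp hu.1 hmaps).of_le (by norm_num)
  have hw0 : ∀ x ∉ S, f (u x) * η x = 0 := fun x hx => by rw [hη0 x hx, mul_zero]
  have hw : ContDiff ℝ 1 (fun y => f (u y) * η y) :=
    MEMS.contDiff_of_contDiffOn_compact hS.isClosed Metric.isOpen_ball hSU
      (hF1.mul (hη.of_le (by norm_num)).contDiffOn) hw0
  -- A global C¹ function equal to f(u) on the ball of radius 1/2; its gradient is an admissible
  -- weak gradient there and so bounds the infimum defining the norm.
  set w := fun y => f (u y) * η y
  have hvw : EqOn (fun x => f (u x)) w (Metric.ball 0 (1 / 2)) := fun x hx => by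
    simp only [w, hη1 x (Metric.ball_subset_closedBall hx), mul_one]
  have hgw : Continuous (gradient w) :=
    continuousOn_univ.1 (MEMS.continuousOn_gradient isOpen_univ hw.contDiffOn)
  have hgw0 := MEMS.gradient_eq_zero_of_notMem hS.isClosed hw0
  have i1 : Integrable fun x => ‖w x‖ ^ 2 :=
    MEMS.integrable_of_continuousOn_compact hS (hw.continuous.norm.pow 2).continuousOn
      fun x hx => by simp [w, hη0 x hx]
  have i2 : Integrable fun x => ‖gradient w x‖ ^ 2 :=
    MEMS.integrable_of_continuousOn_compact hS (hgw.norm.pow 2).continuousOn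
      fun x hx => by simp [w, hgw0 x hx]
  have hui : IntegrableOn u (Metric.ball 0 (3 / 4)) :=
    ((hu.1.continuousOn.mono (Metric.closedBall_subset_ball (by norm_num))).integrableOn_compact
      (isCompact_closedBall 0 (3 / 4))).mono_set Metric.ball_subset_closedBall
  have huW : eLpNorm u 1 (volume.restrict (Metric.ball 0 (3 / 4))) =
      ENNReal.ofReal (∫ x in Metric.ball 0 (3 / 4), u x) := by
    rw [eLpNorm_one_eq_lintegral_enorm, ← ofReal_integral_norm_eq_lintegral_enorm hui]
    congr 1
    exact setIntegral_congr_fun Metric.isOpen_ball.measurableSet fun x hx =>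
      abs_of_nonneg (hu.2.1 x (Metric.ball_subset_ball (by norm_num) hx)).1
  have hW : 0 ≤ ∫ x in Metric.ball 0 (3 / 4), u x :=
    setIntegral_nonneg Metric.isOpen_ball.measurableSet fun x hx =>
      (hu.2.1 x (Metric.ball_subset_ball (by norm_num) hx)).1
  have hvn : eLpNorm (fun x => f (u x)) 2 (volume.restrict (Metric.ball 0 (1 / 2))) =
      eLpNorm w 2 (volume.restrict (Metric.ball 0 (1 / 2))) :=
    eLpNorm_congr_ae (ae_restrict_of_forall_mem Metric.isOpen_ball.measurableSet hvw)
  refine (iInf₂_le (gradient w)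
    (MEMS.hasWeakGradient_of_contDiff Metric.isOpen_ball hw hvw)).trans ?_
  rw [huW, ← ENNReal.ofReal_mul (Real.sqrt_nonneg _), hvn]
  have hsum : eLpNorm w 2 (volume.restrict (Metric.ball 0 (1 / 2))) ^ 2 +
      eLpNorm (gradient w) 2 (volume.restrict (Metric.ball 0 (1 / 2))) ^ 2 ≤
      ENNReal.ofReal ((√C * ∫ x in Metric.ball 0 (3 / 4), u x) ^ 2) := by
    refine (add_le_add (MEMS.eLpNorm_two_restrict_sq_le i1)
      (MEMS.eLpNorm_two_restrict_sq_le i2)).trans ?_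
    rw [← ENNReal.ofReal_add (integral_nonneg fun x => sq_nonneg _)
      (integral_nonneg fun x => sq_nonneg _)]
    refine ENNReal.ofReal_le_ofReal ?_
    rw [mul_pow, Real.sq_sqrt hC.le]
    simpa only [Real.norm_eq_abs, sq_abs] using hE
  refine (ENNReal.rpow_le_rpow hsum (by norm_num)).trans_eq ?_
  rw [ENNReal.ofReal_rpow_of_nonneg (sq_nonneg _) (by norm_num), ← Real.sqrt_eq_rpow,
    Real.sqrt_sq (mul_nonneg (Real.sqrt_nonneg _) hW)]
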